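/- **The game.** Let $A\subseteq\mathbb R$ be an interval and let $\pi:A\times A\to\mathbb R$ be continuous, where $\pi(a,b)$ is the payoff of a player who plays $a$ against $b$ in a symmetric two-player stage game. Assume that $\max_{c\in A}\pi(c,b)$ exists for every $b\in A$, and let $(a^N,a^N)$ be a Nash equilibrium of the stage game. Put $$G(a)=\max_{c\in A}\pi(c,a)-\pi(a,a),\qquad L(a)=\pi(a,a)-\pi(a^N,a^N).$$ Let $\lambda>0$ and $T>0$. In the revision game, played over $[-T,0]$, both players choose actions simultaneously at $-T$; afterwards revision opportunities arrive according to a Poisson process with rate $\lambda$, and at each arrival both players simultaneously choose actions again, knowing all past arrival times and actions. The actions chosen last are in force at the deadline $0$, when the stage-game payoffs are realized. A strategy assigns an action to every (past history, present time) at which a choice may have to be made, measurably in the history and the time. A strategy profile is a subgame perfect equilibrium (SPE) if after every history no player can raise her expected payoff by a unilateral change of strategy; this refers both to the subgames that begin with a choice of actions (at $-T$, or at an arrival at any date $-t\in(-T,0]$) and to those that begin at a date without an arrival. **LR strategies.** Let $x:[0,T]\to A$ be a measurable plan such that $t\mapsto\pi(x(t),x(t))$ is integrable on $[0,T]$, and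 let $k\in(0,1)$. Under the limited retaliation (LR) strategy $\{x(\cdot),k\}$ a player who can choose at date $-t$ chooses $x(t)$, unless a retaliation phase is under way, in which case she chooses $a^N$. A retaliation phase starts whenever, at a choice at some date $-t$ outside any retaliation phase, at least one player takes an action other than $x(t)$; it covers the dates in $(-t,-t+kt]$. Actions taken during a retaliation phase have no influence on later play. **Theorem 1 (SPE constraint).** The profile in which both players use the LR strategy $\{x(\cdot),k\}$ is a subgame perfect equilibrium of the revision game if and only if, for every $t\in[0,T]$, $$G(x(t))\,e^{-\lambda t}\;\le\;\int_{t-kt}^{t}L(x(s))\,\lambda e^{-\lambda s}\,ds .$$ -/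

import Mathlib

/-- A two-player symmetric stage game together with the data of its revision game.
`u a b` is the payoff of a player who plays `a` while her opponent plays `b`. -/
structure RevisionGame where
  /-- the action space, an interval of real numbers -/
  A : Set ℝ
  convex_A : Convex ℝ A
  u : A → A → ℝ
  continuous_u : Continuous fun p : A × A => u p.1 p.2
  /-- the maximum in the definition of the deviation gain exists -/
  exists_bestReply : ∀ b : A, ∃ a : A, ∀ c : A, u c b ≤ u a b
  /-- the Nash (defection) action -/
  aN : A
  nash : ∀ a : A, u a aN ≤ u aN aN
  /-- the Poisson arrival rate -/
  rate : ℝ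
  rate_pos : 0 < rate
  /-- the length of the game, which is played over `[-T, 0]` -/
  T : ℝ
  T_pos : 0 < T

namespace RevisionGame

open MeasureTheory ProbabilityTheory

variable (Γ : RevisionGame)

/-- The deviation gain `G(a) = max_c u(c, a) - u(a, a)`. -/
noncomputable def G (a : Γ.A) : ℝ := (⨆ c : Γ.A, Γ.u c a) - Γ.u a a

/-- The retaliation loss `L(a) = u(a, a) - u(aN, aN)`. -/
def L (a : Γ.A) : ℝ := Γ.u a a - Γ.u Γ.aN Γ.aN

/-! Times are always measured by the remaining time `t` until the deadline: `t` stands for the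
date `-t`. -/

/-- A history lists the past occasions at which the players chose actions, the most recent one
first, each with its (remaining) time and the action profile chosen. The oldest entry is the initial
choice at time `T`, all others are revisions. -/
abbrev History : Type := List (ℝ × (Fin 2 → Γ.A))

/-- After the history `h`, the players may get to choose actions at time `t`: the initial choice is
made at `T`, and a revision takes place strictly after all earlier choices, up to the deadline. -/
def ChoiceAt : Γ.History → ℝ → Prop
  | [], t => t = Γ.T
  | e :: _, t => 0 ≤ t ∧ t < e.1

/-- The histories that can arise. -/
def IsHistory : Γ.History → Prop
  | [] => True
  | e :: h => Γ.ChoiceAt h e.1 ∧ IsHistory h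

/-- A (pure) strategy says which action to take when one can choose at time `t` after the history
`h`. -/
abbrev Strategy : Type := Γ.History → ℝ → Γ.A

/-- A strategy is measurable if, for each number `n` of past choices, the action is a measurable
function of the data of these choices and of the current time. -/
def IsMeasurableStrategy (σ : Γ.Strategy) : Prop :=
  ∀ n : ℕ, Measurable fun p : (Fin n → ℝ × (Fin 2 → Γ.A)) × ℝ => σ (List.ofFn p.1) p.2

/-- A strategy profile. -/
abbrev Profile : Type := Fin 2 → Γ.Strategy

/-- Both players choose simultaneously at time `t` after `h`; the result is added to the history. -/
def choose (σ : Γ.Profile) (h : Γ.History) (t : ℝ) : Γ.History :=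
  (t, fun i => σ i h t) :: h

/-- The law of the waiting times between successive arrivals of a Poisson process:
independent, exponential with parameter `rate`. -/
noncomputable def waitingLaw : Measure (ℕ → ℝ) :=
  haveI : IsProbabilityMeasure (expMeasure Γ.rate) := isProbabilityMeasure_expMeasure Γ.rate_pos
  Measure.infinitePi fun _ : ℕ => expMeasure Γ.rate

/-- The remaining time at the `n`-th arrival (`n = 0, 1, …`) after time `t`, for the waiting times
`w`. It is negative when the arrival comes after the deadline. -/
def arrival (t : ℝ) (w : ℕ → ℝ) (n : ℕ) : ℝ := t - ∑ m ∈ Finset.range (n + 1), w m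

/-- The number of arrivals after time `t` and not after the deadline: the index of the first arrival
that comes too late (it exists with probability one). -/
noncomputable def numArrivals (t : ℝ) (w : ℕ → ℝ) : ℕ := sInf {n | arrival t w n < 0}

/-- The history after `n` further revisions, starting at time `t` from the history `h`, if the
players follow `σ`. -/
def play (σ : Γ.Profile) (h : Γ.History) (t : ℝ) (w : ℕ → ℝ) : ℕ → Γ.History
  | 0 => h
  | n + 1 => Γ.choose σ (play σ h t w n) (arrival t w n)

/-- The payoff of player `i` at the deadline, given by the last profile of actions chosen. (The
value for the empty history is never used, as there always is an initial choice.) -/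
def finalPayoff (i : Fin 2) : Γ.History → ℝ
  | [] => 0
  | e :: _ => Γ.u (e.2 i) (e.2 i.rev)

/-- The realized payoff of player `i` when the waiting times after time `t` are `w`. -/
noncomputable def realizedPayoff (σ : Γ.Profile) (i : Fin 2) (h : Γ.History) (t : ℝ)
    (w : ℕ → ℝ) : ℝ :=
  Γ.finalPayoff i (Γ.play σ h t w (numArrivals t w))

/-- The expected payoff of player `i` from time `t` on, if `h` contains all choices made so far
(including one at time `t`, if there is one) and the players follow `σ` afterwards. It is the
expectation of the positive part minus that of the negative part, so that strategies with a
non-integrable payoff are covered; `∞ - ∞` is read as `-∞`. -/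
noncomputable def expectedPayoff (σ : Γ.Profile) (i : Fin 2) (h : Γ.History) (t : ℝ) : EReal :=
  ((∫⁻ w, ENNReal.ofReal (Γ.realizedPayoff σ i h t w) ∂Γ.waitingLaw : ENNReal) : EReal) -
    ((∫⁻ w, ENNReal.ofReal (-Γ.realizedPayoff σ i h t w) ∂Γ.waitingLaw : ENNReal) : EReal)

/-- `σ` is a subgame perfect equilibrium: no player has a profitable deviation to another strategy,
neither in a subgame that begins with a choice of actions at some time `t`, nor in one that begins
at a time `t` with the actions chosen last still in place. -/
structure IsSPE (σ : Γ.Profile) : Prop where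
  measurable : ∀ i, Γ.IsMeasurableStrategy (σ i)
  at_choice : ∀ (h : Γ.History) (t : ℝ), Γ.IsHistory h → Γ.ChoiceAt h t →
    ∀ (i : Fin 2) (τ : Γ.Strategy), Γ.IsMeasurableStrategy τ →
      Γ.expectedPayoff (Function.update σ i τ) i (Γ.choose (Function.update σ i τ) h t) t ≤
        Γ.expectedPayoff σ i (Γ.choose σ h t) t
  between_choices : ∀ (e : ℝ × (Fin 2 → Γ.A)) (h : Γ.History) (t : ℝ), Γ.IsHistory (e :: h) →
    0 ≤ t → t ≤ e.1 →
    ∀ (i : Fin 2) (τ : Γ.Strategy), Γ.IsMeasurableStrategy τ →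
      Γ.expectedPayoff (Function.update σ i τ) i (e :: h) t ≤ Γ.expectedPayoff σ i (e :: h) t

/-- `Γ.Retaliating x k h s`: a choice at time `s` after the history `h` falls into a retaliation
phase. Let `t` be the time of the last choice in `h`. If that choice itself fell into a retaliation
phase, then it had no influence on later play, and the phase may still go on at `s`. If not, then a
retaliation phase is under way at `s` exactly when somebody deviated from `x t` at `t` and the dates
`-t + k t` and `-s` satisfy `-s ≤ -t + k t`. -/
def Retaliating (x : ℝ → Γ.A) (k : ℝ) : Γ.History → ℝ → Prop
  | [], _ => False
  | e :: h, s =>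
    (Retaliating x k h e.1 ∧ Retaliating x k h s) ∨
      (¬ Retaliating x k h e.1 ∧ (∃ i, e.2 i ≠ x e.1) ∧ e.1 - k * e.1 ≤ s)

open Classical in
/-- The limited retaliation strategy `{x(·), k}`. -/
noncomputable def LR (x : ℝ → Γ.A) (k : ℝ) : Γ.Strategy := fun h t =>
  if Γ.Retaliating x k h t then Γ.aN else x t

/-- Both players use the limited retaliation strategy `{x(·), k}`. -/
noncomputable def LRProfile (x : ℝ → Γ.A) (k : ℝ) : Γ.Profile := fun _ => Γ.LR x k

end RevisionGame

/-! The proof rests on the law of the last arrival: from remaining time `t` no revision comes with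
probability `exp (-rate * t)`, and otherwise the last one has density `rate * exp (-rate * s)` on
`(0, t]` (`lintegral_last_arrival`). When both players use limited retaliation, no new phase ever
starts, so the current history fixes the retaliation status of all later dates. The payoff then
depends on the arrivals only through the last one, and the value is the explicit integral
`pathValue`. A single deviation at `t` outside a phase changes the path only during the phase it
triggers. The stage gain survives with weight `exp (-rate * t)`, and the loss is the integral of `L`
over the phase (`pathValue_sub_of_deviation`).

Sufficiency: the constraint rules out single deviations outside a phase, and the Nash property rules
them out inside one. An arbitrary deviation `τ` is approximated by hybrids that use `τ` for the
first `n` choices and then return. Each additional use of `τ` weakly lowers the payoff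
(`integral_followUntil_succ_le`), and on every path the hybrids eventually agree with `τ`, so
dominated convergence applies. Payoffs may be unbounded; the domination comes from the constraint
itself, which bounds `G (x t)` (`bddAbove_G_of_constraint`), while a deviation whose negative part
has infinite mean is worth `⊥`.

Necessity: single deviations to `a ≠ x t` give the inequality with `u a (x t) - u (x t) (x t)` in
place of `G (x t)`. Since the best reply may be `x t` itself, which triggers no retaliation, the
inequality is extended to it by continuity and density (`constraint_of_isSPE`). -/

namespace RevisionGame

open MeasureTheory ProbabilityTheory Filter Topology
open scoped ENNReal

/-! ### Renewal structure of the waiting times. -/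

section WaitingTimes

/-- The first `j + 1` terms of `w`, followed by the sequence `v`. -/
def splice (j : ℕ) (w v : ℕ → ℝ) : ℕ → ℝ := fun n => if n ≤ j then w n else v (n - (j + 1))

lemma splice_of_le {j n : ℕ} (h : n ≤ j) (w v : ℕ → ℝ) : splice j w v n = w n := if_pos h

lemma splice_add (j n : ℕ) (w v : ℕ → ℝ) : splice j w v (j + 1 + n) = v n := by
  rw [splice, if_neg (by omega), Nat.add_sub_cancel_left]

lemma measurable_splice (j : ℕ) :
    Measurable fun p : (ℕ → ℝ) × (ℕ → ℝ) => splice j p.1 p.2 := by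
  refine measurable_pi_lambda _ fun n => ?_
  by_cases h : n ≤ j
  · simp only [splice, h, if_true]; fun_prop
  · simp only [splice, h, if_false]; fun_prop

lemma measurable_arrival (t : ℝ) (n : ℕ) : Measurable fun w => arrival t w n := by
  unfold arrival; fun_prop

lemma arrival_splice_of_le (t : ℝ) {j n : ℕ} (h : n ≤ j) (w v : ℕ → ℝ) :
    arrival t (splice j w v) n = arrival t w n := by
  unfold arrival
  congr 1
  refine Finset.sum_congr rfl fun m hm => splice_of_le ?_ w v
  rw [Finset.mem_range] at hm; omega

lemma arrival_splice_add (t : ℝ) (j n : ℕ) (w v : ℕ → ℝ) :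
    arrival t (splice j w v) (j + 1 + n) = arrival (arrival t w j) v n := by
  unfold arrival
  rw [add_assoc, Finset.sum_range_add, sub_sub]
  congr 2
  · refine Finset.sum_congr rfl fun m hm => splice_of_le ?_ w v
    rw [Finset.mem_range] at hm; omega
  · exact Finset.sum_congr rfl fun m _ => splice_add j m w v

lemma arrival_zero (t : ℝ) (w : ℕ → ℝ) : arrival t w 0 = t - w 0 := by simp [arrival]

lemma arrival_succ (t : ℝ) (w : ℕ → ℝ) (n : ℕ) :
    arrival t w (n + 1) = arrival t w n - w (n + 1) := by
  simp only [arrival, Finset.sum_range_succ _ (n + 1)]; ring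

lemma arrival_antitone (t : ℝ) {w : ℕ → ℝ} (hw : ∀ n, 0 ≤ w n) : Antitone (arrival t w) :=
  antitone_nat_of_succ_le fun n => by rw [arrival_succ]; linarith [hw (n + 1)]

lemma arrival_le (t : ℝ) {w : ℕ → ℝ} (hw : ∀ n, 0 ≤ w n) (n : ℕ) : arrival t w n ≤ t :=
  sub_le_self _ (Finset.sum_nonneg fun m _ => hw m)

lemma numArrivals_eq_succ_iff {t : ℝ} {w : ℕ → ℝ} (hw : ∀ n, 0 ≤ w n)
    (hfin : ∃ n, arrival t w n < 0) (n : ℕ) :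
    numArrivals t w = n + 1 ↔ 0 ≤ arrival t w n ∧ arrival t w (n + 1) < 0 := by
  have hanti := arrival_antitone t hw
  constructor
  · intro h
    refine ⟨?_, ?_⟩
    · have : n ∉ {n | arrival t w n < 0} := Nat.notMem_of_lt_sInf (by
        change n < numArrivals t w; omega)
      simpa using this
    · have := Nat.sInf_mem (s := {n | arrival t w n < 0}) hfin
      change arrival t w (numArrivals t w) < 0 at this
      rwa [h] at this
  · rintro ⟨h0, h1⟩
    refine le_antisymm (Nat.sInf_le h1) ?_
    refine le_csInf hfin fun b hb => ?_
    by_contra hlt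
    have : arrival t w n ≤ arrival t w b := hanti (by omega)
    have hb' : arrival t w b < 0 := hb
    linarith

lemma numArrivals_eq_zero_iff {t : ℝ} {w : ℕ → ℝ} (hfin : ∃ n, arrival t w n < 0) :
    numArrivals t w = 0 ↔ arrival t w 0 < 0 := by
  constructor
  · intro h
    have := Nat.sInf_mem (s := {n | arrival t w n < 0}) hfin
    change arrival t w (numArrivals t w) < 0 at this
    rwa [h] at this
  · intro h
    exact Nat.sInf_eq_zero.2 (Or.inl h)

/-- Arrival `j` being in time, so are all earlier ones, and the count restarts there. -/
lemma numArrivals_splice {t : ℝ} {j : ℕ} {w v : ℕ → ℝ} (hw : ∀ n, 0 ≤ w n)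
    (hj : 0 ≤ arrival t w j) (hfin : ∃ n, arrival (arrival t w j) v n < 0) :
    numArrivals t (splice j w v) = j + 1 + numArrivals (arrival t w j) v := by
  refine le_antisymm (Nat.sInf_le ?_) (le_csInf ?_ fun b hb => ?_)
  · change arrival t (splice j w v) (j + 1 + numArrivals (arrival t w j) v) < 0
    rw [arrival_splice_add]
    exact Nat.sInf_mem (s := {n | arrival (arrival t w j) v n < 0}) hfin
  · obtain ⟨n, hn⟩ := hfin
    exact ⟨j + 1 + n, by rw [Set.mem_ofPred_eq, arrival_splice_add]; exact hn⟩
  · have hb' : arrival t (splice j w v) b < 0 := hb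
    by_cases hbj : b ≤ j
    · rw [arrival_splice_of_le t hbj] at hb'
      linarith [arrival_antitone t hw hbj]
    · obtain ⟨c, rfl⟩ := Nat.exists_eq_add_of_le (show j + 1 ≤ b by omega)
      rw [arrival_splice_add] at hb'
      exact Nat.add_le_add_left (Nat.sInf_le hb') _

lemma measurable_numArrivals (t : ℝ) : Measurable (numArrivals t) := by
  have hS : ∀ n, MeasurableSet {w | arrival t w n < 0} := fun n =>
    measurableSet_lt (measurable_arrival t n) measurable_const
  refine measurable_to_countable' fun n => ?_
  -- The second piece accounts for `sInf ∅ = 0`: paths without a late arrival are counted at `n =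
  -- 0`.
  have : numArrivals t ⁻¹' {n} =
      ({w | arrival t w n < 0} ∩ ⋂ m ∈ Finset.range n, {w | arrival t w m < 0}ᶜ) ∪
        {w | n = 0 ∧ w ∈ ⋂ m : ℕ, {w | arrival t w m < 0}ᶜ} := by
    ext w
    simp only [Set.mem_preimage, Set.mem_singleton_iff, Set.mem_union, Set.mem_inter_iff,
      Set.mem_ofPred_eq, Set.mem_iInter, Set.mem_compl_iff, Finset.mem_range]
    by_cases hfin : ∃ n, arrival t w n < 0
    · have hno : ¬ ∀ m, ¬ arrival t w m < 0 := by push Not; exact hfin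
      simp only [hno, and_false, or_false]
      constructor
      · rintro rfl
        exact ⟨Nat.sInf_mem (s := {n | arrival t w n < 0}) hfin,
          fun m hm => Nat.notMem_of_lt_sInf hm⟩
      · rintro ⟨h1, h2⟩
        refine le_antisymm (Nat.sInf_le h1) (le_csInf hfin fun b hb => ?_)
        by_contra hlt
        exact h2 b (by omega) hb
    · have hall : ∀ m, ¬ arrival t w m < 0 := by push Not at hfin ⊢; exact hfin
      have h0 : numArrivals t w = 0 := Nat.sInf_eq_zero.2 (Or.inr (by
        ext m; simpa using hall m))
      rw [h0]
      simp only [hall n, false_and, false_or]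
      exact ⟨fun h => ⟨h.symm, hall⟩, fun h => h.1.symm⟩
  rw [this]
  refine ((hS n).inter (Finset.measurableSet_biInter _ fun m _ => (hS m).compl)).union ?_
  by_cases hn : n = 0
  · simp only [hn, true_and]
    exact MeasurableSet.iInter fun m => (hS m).compl
  · simp [hn]

variable (Γ : RevisionGame)

instance : IsProbabilityMeasure (expMeasure Γ.rate) :=
  isProbabilityMeasure_expMeasure Γ.rate_pos

instance : IsProbabilityMeasure Γ.waitingLaw := by
  unfold waitingLaw; infer_instance

lemma waitingLaw_pi (s : Finset ℕ) (t : ℕ → Set ℝ) (ht : ∀ i ∈ s, MeasurableSet (t i)) :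
    Γ.waitingLaw (Set.pi s t) = ∏ i ∈ s, expMeasure Γ.rate (t i) := by
  unfold waitingLaw
  exact Measure.infinitePi_pi _ ht

/-- The waiting times after the `j`-th are independent of the first ones, with the same law. -/
lemma measurePreserving_splice (j : ℕ) :
    MeasurePreserving (fun p : (ℕ → ℝ) × (ℕ → ℝ) => splice j p.1 p.2)
      (Γ.waitingLaw.prod Γ.waitingLaw) Γ.waitingLaw := by
  refine ⟨measurable_splice j, ?_⟩
  -- A product law is determined on finite boxes, and the preimage of a box splits into a box in the
  -- first `j + 1` coordinates of `w` times a shifted box in `v`.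
  refine Measure.eq_infinitePi _ fun s t ht => ?_
  have hms : MeasurableSet (Set.pi (s : Set ℕ) t) :=
    MeasurableSet.pi s.countable_toSet fun i _ => ht i
  rw [Measure.map_apply (measurable_splice j) hms]
  have hinj : Set.InjOn (fun n => n - (j + 1)) (s.filter fun n => ¬ n ≤ j : Finset ℕ) := by
    intro a ha b hb hab
    simp only [Finset.coe_filter, Set.mem_ofPred_eq] at ha hb hab
    omega
  have hpre : (fun p : (ℕ → ℝ) × (ℕ → ℝ) => splice j p.1 p.2) ⁻¹' (Set.pi (s : Set ℕ) t) =
      (Set.pi ((s.filter fun n => n ≤ j : Finset ℕ) : Set ℕ) t) ×ˢ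
        (Set.pi (((s.filter fun n => ¬ n ≤ j).image fun n => n - (j + 1) : Finset ℕ) : Set ℕ)
          fun m => t (j + 1 + m)) := by
    ext ⟨w, v⟩
    simp only [Set.mem_preimage, Set.mem_pi, Set.mem_prod, Finset.mem_coe, Finset.mem_filter,
      Finset.mem_image, and_imp, forall_exists_index]
    constructor
    · intro H
      refine ⟨fun i hi hij => ?_, fun i n hn hnj hni => ?_⟩
      · have := H i hi
        rwa [splice_of_le hij] at this
      · have := H n hn
        subst hni
        have e : n = j + 1 + (n - (j + 1)) := by omega
        rw [e, splice_add] at this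
        exact this
    · rintro ⟨H1, H2⟩ n hn
      by_cases hnj : n ≤ j
      · rw [splice_of_le hnj]; exact H1 n hn hnj
      · have := H2 (n - (j + 1)) n hn hnj rfl
        have e : j + 1 + (n - (j + 1)) = n := by omega
        rw [e] at this
        rwa [splice, if_neg hnj]
  rw [hpre, Measure.prod_prod, waitingLaw_pi _ _ _ fun i _ => ht i,
    waitingLaw_pi _ _ _ fun i _ => ht _, Finset.prod_image hinj,
    ← Finset.prod_filter_mul_prod_filter_not s (fun n => n ≤ j)]
  congr 1
  refine Finset.prod_congr rfl fun n hn => ?_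
  rw [Finset.mem_filter] at hn
  congr 2
  omega

lemma lintegral_splice (j : ℕ) {f : (ℕ → ℝ) → ℝ≥0∞} (hf : Measurable f) :
    ∫⁻ w, f w ∂Γ.waitingLaw = ∫⁻ w, ∫⁻ v, f (splice j w v) ∂Γ.waitingLaw ∂Γ.waitingLaw := by
  rw [← (Γ.measurePreserving_splice j).lintegral_comp hf]
  exact lintegral_prod _ (hf.comp (measurable_splice j)).aemeasurable

lemma expMeasure_eq_withDensity (r : ℝ) :
    expMeasure r = volume.withDensity (exponentialPDF r) := rfl

lemma map_eval_waitingLaw (n : ℕ) :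
    Γ.waitingLaw.map (fun w => w n) = expMeasure Γ.rate := by
  unfold waitingLaw
  exact Measure.infinitePi_map_eval _ n

lemma lintegral_eval_waitingLaw (n : ℕ) {g : ℝ → ℝ≥0∞} (hg : Measurable g) :
    ∫⁻ w, g (w n) ∂Γ.waitingLaw =
      ∫⁻ s in Set.Ici 0, g s * ENNReal.ofReal (Γ.rate * Real.exp (-Γ.rate * s)) := by
  rw [← lintegral_map hg (measurable_pi_apply n), map_eval_waitingLaw, expMeasure_eq_withDensity,
    lintegral_withDensity_eq_lintegral_mul _ (by unfold exponentialPDF; fun_prop) hg,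
    ← lintegral_indicator measurableSet_Ici]
  refine lintegral_congr fun s => ?_
  by_cases hs : 0 ≤ s
  · simp [hs, exponentialPDF_of_nonneg, mul_comm]
  · simp [hs, exponentialPDF_of_neg (not_le.1 hs)]

lemma ae_waiting_nonneg : ∀ᵐ w ∂Γ.waitingLaw, ∀ n, 0 ≤ w n := by
  rw [ae_all_iff]
  intro n
  have h : MeasurableSet {w : ℕ → ℝ | ¬ 0 ≤ w n} :=
    (measurableSet_le measurable_const (measurable_pi_apply n)).compl
  rw [ae_iff, ← lintegral_indicator_one h]
  have : ∀ w : ℕ → ℝ, Set.indicator {w : ℕ → ℝ | ¬ 0 ≤ w n} (1 : (ℕ → ℝ) → ℝ≥0∞) w =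
      Set.indicator (Set.Iio 0) 1 (w n) := by
    intro w; by_cases h : w n < 0 <;> simp [Set.indicator, h]
  simp_rw [this]
  rw [Γ.lintegral_eval_waitingLaw n (measurable_one.indicator measurableSet_Iio),
    setLIntegral_congr_fun (g := fun _ => 0) measurableSet_Ici]
  · simp
  · intro s hs
    have hs' : 0 ≤ s := hs
    simp [not_lt.2 hs']

lemma waiting_tail (n : ℕ) {t : ℝ} (ht : 0 ≤ t) :
    Γ.waitingLaw {w | t < w n} = ENNReal.ofReal (Real.exp (-Γ.rate * t)) := by
  have e : {w : ℕ → ℝ | t < w n} = (fun w => w n) ⁻¹' (Set.Iic t)ᶜ := by ext w; simp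
  rw [e, ← Measure.map_apply (measurable_pi_apply n) measurableSet_Iic.compl, map_eval_waitingLaw,
    prob_compl_eq_one_sub measurableSet_Iic, ← ofReal_cdf, cdf_expMeasure_eq Γ.rate_pos, if_pos ht,
    ← ENNReal.ofReal_one, ← ENNReal.ofReal_sub]
  · congr 1; rw [neg_mul]; ring
  · rw [sub_nonneg, Real.exp_le_one_iff, neg_nonpos]
    exact mul_nonneg Γ.rate_pos.le ht

end WaitingTimes

/-! ### Poisson arrivals and the law of the last one. -/

section Arrivals

variable (Γ : RevisionGame)

lemma lintegral_sub_pow_div_factorial (n : ℕ) {r : ℝ} (hr : 0 ≤ r) :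
    ∫⁻ y in Set.Icc 0 r, ENNReal.ofReal ((r - y) ^ n / n.factorial) =
      ENNReal.ofReal (r ^ (n + 1) / (n + 1).factorial) := by
  rw [← ofReal_integral_eq_lintegral_ofReal]
  · rw [integral_Icc_eq_integral_Ioc, ← intervalIntegral.integral_of_le hr,
      intervalIntegral.integral_div,
      intervalIntegral.integral_comp_sub_left (fun y => y ^ n) r]
    simp only [sub_self, sub_zero, integral_pow, Nat.factorial_succ]
    push_cast
    congr 1
    field_simp
    simp
  · exact (Continuous.integrableOn_Icc (by fun_prop))
  · refine (ae_restrict_iff' measurableSet_Icc).2 (ae_of_all _ fun y hy => ?_)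
    have : 0 ≤ r - y := sub_nonneg.2 hy.2
    change (0 : ℝ) ≤ _
    positivity

/-- The time of the `n`-th event of the Poisson process has an Erlang distribution. -/
lemma lintegral_sum_waiting (n : ℕ) {g : ℝ → ℝ≥0∞} (hg : Measurable g) :
    ∫⁻ w, g (∑ m ∈ Finset.range (n + 1), w m) ∂Γ.waitingLaw =
      ∫⁻ s in Set.Ici 0, g s *
        ENNReal.ofReal (Γ.rate ^ (n + 1) * Real.exp (-Γ.rate * s) * (s ^ n / n.factorial)) := by
  induction n generalizing g with
  | zero =>
    simp only [zero_add, Finset.range_one, Finset.sum_singleton]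
    rw [Γ.lintegral_eval_waitingLaw 0 hg]
    simp
  | succ n ih =>
    have hmeas : Measurable fun w : ℕ → ℝ => g (∑ m ∈ Finset.range (n + 1 + 1), w m) := by
      fun_prop
    have hr := Γ.rate_pos
    -- Split off the first waiting time; the sum of the others is an independent copy covered by the
    -- induction hypothesis, which leaves a convolution.
    rw [Γ.lintegral_splice 0 hmeas]
    have key : ∀ w v : ℕ → ℝ, ∑ m ∈ Finset.range (n + 1 + 1), splice 0 w v m =
        w 0 + ∑ m ∈ Finset.range (n + 1), v m := by
      intro w v
      rw [Finset.sum_range_succ', add_comm]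
      congr 1
    simp_rw [key]
    have step : ∀ w : ℕ → ℝ, ∫⁻ v, g (w 0 + ∑ m ∈ Finset.range (n + 1), v m) ∂Γ.waitingLaw =
        (fun y => ∫⁻ s in Set.Ici 0, g (y + s) *
        ENNReal.ofReal (Γ.rate ^ (n + 1) * Real.exp (-Γ.rate * s) * (s ^ n / n.factorial))) (w 0) :=
      fun w => ih (g := fun s => g (w 0 + s)) (by fun_prop)
    simp_rw [step]
    rw [Γ.lintegral_eval_waitingLaw 0 (g := fun y => ∫⁻ s in Set.Ici 0, g (y + s) *
        ENNReal.ofReal (Γ.rate ^ (n + 1) * Real.exp (-Γ.rate * s) * (s ^ n / n.factorial)))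
      (Measurable.lintegral_prod_right' (f := fun p : ℝ × ℝ => g (p.1 + p.2) *
        ENNReal.ofReal (Γ.rate ^ (n + 1) * Real.exp (-Γ.rate * p.2) * (p.2 ^ n / n.factorial)))
        (by fun_prop))]
    -- After translating by `y` the exponentials merge into a factor free of `y`, so only the power
    -- of `s - y` remains to be integrated over `y`.
    have inner : ∀ y : ℝ, (∫⁻ s in Set.Ici 0, g (y + s) *
        ENNReal.ofReal (Γ.rate ^ (n + 1) * Real.exp (-Γ.rate * s) * (s ^ n / n.factorial))) *
          ENNReal.ofReal (Γ.rate * Real.exp (-Γ.rate * y)) =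
        ∫⁻ s, (Set.Ici y).indicator (fun s => g s * ENNReal.ofReal
          (Γ.rate ^ (n + 2) * Real.exp (-Γ.rate * s) * ((s - y) ^ n / n.factorial))) s := by
      intro y
      rw [← lintegral_indicator measurableSet_Ici,
        ← lintegral_sub_right_eq_self _ y, ← lintegral_mul_const' _ _ ENNReal.ofReal_ne_top]
      refine lintegral_congr fun s => ?_
      by_cases hs : y ≤ s
      · have h0 : (0 : ℝ) ≤ s - y := sub_nonneg.2 hs
        rw [Set.indicator_of_mem (show s - y ∈ Set.Ici 0 from h0),
          Set.indicator_of_mem (show s ∈ Set.Ici y from hs), mul_assoc,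
          ← ENNReal.ofReal_mul (by positivity)]
        congr 2
        · ring_nf
        · have : Real.exp (-Γ.rate * s) =
            Real.exp (-Γ.rate * (s - y)) * Real.exp (-Γ.rate * y) := by
            rw [← Real.exp_add]; ring_nf
          rw [this]; ring
      · have h0 : ¬ (0 : ℝ) ≤ s - y := by rwa [sub_nonneg]
        rw [Set.indicator_of_notMem (show s - y ∉ Set.Ici 0 from h0),
          Set.indicator_of_notMem (show s ∉ Set.Ici y from hs), zero_mul]
    simp_rw [inner]
    have hset : MeasurableSet {p : ℝ × ℝ | p.1 ≤ p.2} :=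
      measurableSet_le measurable_fst measurable_snd
    have hjoint : Measurable fun p : ℝ × ℝ => (Set.Ici p.1).indicator
        (fun s => g s * ENNReal.ofReal
          (Γ.rate ^ (n + 2) * Real.exp (-Γ.rate * s) * ((s - p.1) ^ n / n.factorial))) p.2 := by
      have : (fun p : ℝ × ℝ => (Set.Ici p.1).indicator
        (fun s => g s * ENNReal.ofReal
          (Γ.rate ^ (n + 2) * Real.exp (-Γ.rate * s) * ((s - p.1) ^ n / n.factorial))) p.2) =
          {p : ℝ × ℝ | p.1 ≤ p.2}.indicator fun p => g p.2 * ENNReal.ofReal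
          (Γ.rate ^ (n + 2) * Real.exp (-Γ.rate * p.2) * ((p.2 - p.1) ^ n / n.factorial)) := by
        ext p; simp [Set.indicator]
      rw [this]
      exact Measurable.indicator (by fun_prop) hset
    rw [lintegral_lintegral_swap (μ := volume.restrict (Set.Ici 0)) (ν := volume)
      (f := fun y s => (Set.Ici y).indicator (fun s => g s * ENNReal.ofReal
          (Γ.rate ^ (n + 2) * Real.exp (-Γ.rate * s) * ((s - y) ^ n / n.factorial))) s)
      hjoint.aemeasurable, ← lintegral_indicator measurableSet_Ici]
    refine lintegral_congr fun s => ?_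
    have hpull : ∫⁻ y in Set.Ici 0, (Set.Ici y).indicator (fun s => g s * ENNReal.ofReal
          (Γ.rate ^ (n + 2) * Real.exp (-Γ.rate * s) * ((s - y) ^ n / n.factorial))) s =
        ∫⁻ y in Set.Icc 0 s, g s * ENNReal.ofReal
          (Γ.rate ^ (n + 2) * Real.exp (-Γ.rate * s) * ((s - y) ^ n / n.factorial)) := by
      rw [← lintegral_indicator measurableSet_Ici, ← lintegral_indicator measurableSet_Icc]
      refine lintegral_congr fun y => ?_
      by_cases h0 : 0 ≤ y <;> by_cases hs : y ≤ s <;> simp [Set.indicator, h0, hs]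
    rw [hpull]
    by_cases hs : 0 ≤ s
    · rw [Set.indicator_of_mem (show s ∈ Set.Ici 0 from hs)]
      have : ∀ y, g s * ENNReal.ofReal
          (Γ.rate ^ (n + 2) * Real.exp (-Γ.rate * s) * ((s - y) ^ n / n.factorial)) =
          (g s * ENNReal.ofReal (Γ.rate ^ (n + 2) * Real.exp (-Γ.rate * s))) *
            ENNReal.ofReal ((s - y) ^ n / n.factorial) := fun y => by
        rw [ENNReal.ofReal_mul (by positivity), mul_assoc]
      simp_rw [this]
      rw [lintegral_const_mul _ (by fun_prop), lintegral_sub_pow_div_factorial n hs, mul_assoc,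
        ← ENNReal.ofReal_mul (by positivity)]
    · rw [Set.indicator_of_notMem (show s ∉ Set.Ici 0 from hs), Set.Icc_eq_empty hs]
      simp

/-- The expected number of points of a Poisson process is proportional to Lebesgue measure. -/
lemma tsum_lintegral_arrival (t : ℝ) {f : ℝ → ℝ≥0∞} (hf : Measurable f) :
    ∑' n, ∫⁻ w, f (arrival t w n) ∂Γ.waitingLaw =
      ∫⁻ s in Set.Iic t, f s * ENNReal.ofReal Γ.rate := by
  have hr := Γ.rate_pos
  have h1 : ∀ n, ∫⁻ w, f (arrival t w n) ∂Γ.waitingLaw = ∫⁻ s in Set.Ici 0, f (t - s) *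
        ENNReal.ofReal (Γ.rate ^ (n + 1) * Real.exp (-Γ.rate * s) * (s ^ n / n.factorial)) :=
    fun n => Γ.lintegral_sum_waiting n (g := fun s => f (t - s)) (by fun_prop)
  simp_rw [h1]
  rw [← lintegral_tsum fun n => by fun_prop, ← lintegral_indicator measurableSet_Iic,
    ← lintegral_indicator measurableSet_Ici,
    ← lintegral_sub_left_eq_self ((Set.Iic t).indicator fun s => f s * ENNReal.ofReal Γ.rate) t]
  refine lintegral_congr fun s => ?_
  by_cases hs : 0 ≤ s
  · rw [Set.indicator_of_mem (show s ∈ Set.Ici 0 from hs),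
      Set.indicator_of_mem (show t - s ∈ Set.Iic t from sub_le_self _ hs), ENNReal.tsum_mul_left]
    congr 1
    -- The Erlang densities sum to the constant `rate` by the exponential series.
    have hexp : HasSum (fun n : ℕ => Γ.rate ^ (n + 1) * Real.exp (-Γ.rate * s) *
        (s ^ n / n.factorial)) Γ.rate := by
      have h := (NormedSpace.expSeries_div_hasSum_exp (𝔸 := ℝ) (Γ.rate * s)).mul_left
        (Γ.rate * Real.exp (-Γ.rate * s))
      rw [← Real.exp_eq_exp_ℝ, mul_assoc, ← Real.exp_add] at h
      have e1 : (fun n : ℕ => Γ.rate ^ (n + 1) * Real.exp (-Γ.rate * s) * (s ^ n / n.factorial)) =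
          fun n : ℕ => Γ.rate * Real.exp (-Γ.rate * s) * ((Γ.rate * s) ^ n / n.factorial) := by
        funext n; rw [mul_pow]; ring
      have e2 : Γ.rate * Real.exp (-Γ.rate * s + Γ.rate * s) = Γ.rate := by simp
      rw [e2] at h
      rwa [e1]
    rw [← ENNReal.ofReal_tsum_of_nonneg (fun n => by positivity) hexp.summable, hexp.tsum_eq]
  · rw [Set.indicator_of_notMem (show s ∉ Set.Ici 0 from hs),
      Set.indicator_of_notMem (show t - s ∉ Set.Iic t by simpa using hs)]

/-- Borel–Cantelli: the expected number of arrivals before the deadline is finite. -/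
lemma ae_exists_arrival_neg (t : ℝ) : ∀ᵐ w ∂Γ.waitingLaw, ∃ n, arrival t w n < 0 := by
  have hfin : ∑' n, Γ.waitingLaw {w | 0 ≤ arrival t w n} ≠ ∞ := by
    have h : ∀ n, Γ.waitingLaw {w | 0 ≤ arrival t w n} =
        ∫⁻ w, (Set.Ici 0).indicator 1 (arrival t w n) ∂Γ.waitingLaw := fun n => by
      rw [← lintegral_indicator_one (measurableSet_le measurable_const (measurable_arrival t n))]
      rfl
    simp_rw [h]
    rw [Γ.tsum_lintegral_arrival t (measurable_one.indicator measurableSet_Ici),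
      lintegral_mul_const' _ _ ENNReal.ofReal_ne_top, lintegral_indicator_one measurableSet_Ici,
      Measure.restrict_apply measurableSet_Ici, Set.Ici_inter_Iic]
    exact ENNReal.mul_ne_top measure_Icc_lt_top.ne ENNReal.ofReal_ne_top
  filter_upwards [ae_eventually_notMem hfin] with w hw
  obtain ⟨n, hn⟩ := hw.exists
  exact ⟨n, by simpa using hn⟩

/-- The law of the last arrival. -/
lemma lintegral_last_arrival {t : ℝ} (ht : 0 ≤ t) (c : ℝ≥0∞) {f : ℝ → ℝ≥0∞} (hf : Measurable f) :
    ∫⁻ w, (if numArrivals t w = 0 then c else f (arrival t w (numArrivals t w - 1)))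
        ∂Γ.waitingLaw =
      c * ENNReal.ofReal (Real.exp (-Γ.rate * t)) +
        ∫⁻ s in Set.Ioc 0 t, f s * ENNReal.ofReal (Γ.rate * Real.exp (-Γ.rate * s)) := by
  have hr := Γ.rate_pos
  -- `F n` selects the event that arrival `n` is the last one in time: it meets the deadline and the
  -- next waiting time overshoots it. At most one `F n` is nonzero on almost every path.
  set F : ℕ → (ℕ → ℝ) → ℝ≥0∞ := fun n w =>
    (Set.Ici 0).indicator f (arrival t w n) *
      (Set.Ioi (arrival t w n)).indicator 1 (w (n + 1)) with hF
  have hmarr := measurable_arrival t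
  have hFmeas : ∀ n, Measurable (F n) := by
    intro n
    refine ((hf.indicator measurableSet_Ici).comp (hmarr n)).mul ?_
    have : (fun w : ℕ → ℝ => (Set.Ioi (arrival t w n)).indicator (1 : ℝ → ℝ≥0∞) (w (n + 1))) =
        {w : ℕ → ℝ | arrival t w n < w (n + 1)}.indicator 1 := by
      ext w; simp [Set.indicator]
    rw [this]
    exact measurable_one.indicator (measurableSet_lt (hmarr n) (measurable_pi_apply _))
  have hae : ∀ᵐ w ∂Γ.waitingLaw,
      (if numArrivals t w = 0 then c else f (arrival t w (numArrivals t w - 1))) =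
        {w : ℕ → ℝ | t < w 0}.indicator (fun _ => c) w + ∑' n, F n w := by
    filter_upwards [Γ.ae_waiting_nonneg, Γ.ae_exists_arrival_neg t] with w hw hfin
    have hFn : ∀ n, F n w = if numArrivals t w = n + 1 then f (arrival t w n) else 0 := by
      intro n
      simp only [hF, numArrivals_eq_succ_iff hw hfin, arrival_succ, sub_neg, Set.indicator,
        Set.mem_Ici, Set.mem_Ioi, Pi.one_apply]
      by_cases h1 : 0 ≤ arrival t w n <;> by_cases h2 : arrival t w n < w (n + 1) <;> simp [h1, h2]
    simp_rw [hFn]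
    by_cases h0 : numArrivals t w = 0
    · have : t < w 0 := by
        have := (numArrivals_eq_zero_iff hfin).1 h0
        rwa [arrival_zero, sub_neg] at this
      simp [h0, Set.indicator, this]
    · have : ¬ t < w 0 := by
        have := (numArrivals_eq_zero_iff hfin).not.1 h0
        rwa [arrival_zero, sub_neg] at this
      rw [if_neg h0, tsum_eq_single (numArrivals t w - 1), if_pos (by omega)]
      · simp [Set.indicator, this]
      · intro b hb
        rw [if_neg (by omega)]
  rw [lintegral_congr_ae hae, lintegral_add_left
    (measurable_const.indicator (measurableSet_lt measurable_const (measurable_pi_apply 0))),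
    lintegral_tsum fun n => (hFmeas n).aemeasurable]
  congr 1
  · rw [lintegral_indicator_const (measurableSet_lt measurable_const (measurable_pi_apply 0)),
      waiting_tail Γ 0 ht]
  · have h1 : ∀ n, ∫⁻ w, F n w ∂Γ.waitingLaw = ∫⁻ w, (fun s => (Set.Ici 0).indicator f s *
        ENNReal.ofReal (Real.exp (-Γ.rate * s))) (arrival t w n) ∂Γ.waitingLaw := by
      intro n
      rw [Γ.lintegral_splice n (hFmeas n)]
      refine lintegral_congr fun w => ?_
      have h2 : ∀ v, F n (splice n w v) = (Set.Ici 0).indicator f (arrival t w n) *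
          {v : ℕ → ℝ | arrival t w n < v 0}.indicator 1 v := by
        intro v
        have : splice n w v (n + 1) = v 0 := splice_add n 0 w v
        simp only [hF, arrival_splice_of_le t le_rfl, this]
        rfl
      simp_rw [h2]
      rw [lintegral_const_mul _ (measurable_one.indicator
        (measurableSet_lt measurable_const (measurable_pi_apply 0))), lintegral_indicator_one
        (measurableSet_lt measurable_const (measurable_pi_apply 0))]
      by_cases h0 : 0 ≤ arrival t w n
      · rw [waiting_tail Γ 0 h0]
      · simp [Set.indicator, h0]
    simp_rw [h1]
    rw [Γ.tsum_lintegral_arrival t (f := fun s => (Set.Ici 0).indicator f s *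
        ENNReal.ofReal (Real.exp (-Γ.rate * s)))
        ((hf.indicator measurableSet_Ici).mul (by fun_prop)),
      Measure.restrict_congr_set Ioc_ae_eq_Icc, ← lintegral_indicator measurableSet_Iic,
      ← lintegral_indicator measurableSet_Icc]
    refine lintegral_congr fun s => ?_
    have : ∀ s, ENNReal.ofReal (Γ.rate * Real.exp (-Γ.rate * s)) =
        ENNReal.ofReal (Real.exp (-Γ.rate * s)) * ENNReal.ofReal Γ.rate := fun s => by
      rw [mul_comm, ENNReal.ofReal_mul (Real.exp_pos _).le]
    simp only [this]
    by_cases h0 : 0 ≤ s <;> by_cases hs : s ≤ t <;> simp [Set.indicator, h0, hs, mul_assoc]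

lemma integrable_last_arrival {t : ℝ} (ht : 0 ≤ t) (c : ℝ) {f : ℝ → ℝ} (hf : Measurable f)
    (hint : IntegrableOn f (Set.Ioc 0 t)) :
    Integrable (fun w => if numArrivals t w = 0 then c
      else f (arrival t w (numArrivals t w - 1))) Γ.waitingLaw ∧
    ∫ w, (if numArrivals t w = 0 then c else f (arrival t w (numArrivals t w - 1)))
        ∂Γ.waitingLaw =
      c * Real.exp (-Γ.rate * t) +
        ∫ s in Set.Ioc 0 t, f s * (Γ.rate * Real.exp (-Γ.rate * s)) := by
  have hr := Γ.rate_pos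
  set g : (ℕ → ℝ) → ℝ := fun w => if numArrivals t w = 0 then c
      else f (arrival t w (numArrivals t w - 1)) with hg
  have hgmeas : Measurable g := by
    have hset : ∀ n, MeasurableSet {w | numArrivals t w = n} := fun n =>
      measurable_numArrivals t (MeasurableSet.singleton n)
    refine Measurable.ite (hset 0) measurable_const (hf.comp ?_)
    exact (measurable_from_prod_countable_left (f := fun p : (ℕ → ℝ) × ℕ => arrival t p.1 (p.2 - 1))
      fun n => measurable_arrival t (n - 1)).comp
        (measurable_id.prodMk (measurable_numArrivals t))
  have hden : IntegrableOn (fun s => f s * (Γ.rate * Real.exp (-Γ.rate * s))) (Set.Ioc 0 t) := by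
    rw [← integrableOn_Icc_iff_integrableOn_Ioc] at hint ⊢
    exact hint.mul_continuousOn (by fun_prop) isCompact_Icc
  -- A positively homogeneous `φ` lets the density pass inside. The norm gives integrability; the
  -- positive and negative parts give the integral.
  have hpart : ∀ φ : ℝ → ℝ≥0∞, Measurable φ →
      (∀ x a, 0 ≤ a → φ (x * a) = φ x * ENNReal.ofReal a) →
      ∫⁻ w, φ (g w) ∂Γ.waitingLaw = φ (c * Real.exp (-Γ.rate * t)) +
        ∫⁻ s in Set.Ioc 0 t, φ (f s * (Γ.rate * Real.exp (-Γ.rate * s))) := by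
    intro φ hφ hφa
    rw [hφa _ _ (Real.exp_pos _).le, lintegral_congr fun s => hφa (f s) _
      (mul_pos hr (Real.exp_pos (-Γ.rate * s))).le,
      ← Γ.lintegral_last_arrival ht (φ c) (f := fun s => φ (f s)) (hφ.comp hf)]
    exact lintegral_congr fun w => apply_ite φ _ _ _
  have hnorm := hpart (fun x => ‖x‖ₑ) (by fun_prop) fun x a ha => by
    rw [enorm_mul, Real.enorm_of_nonneg ha]
  have hgint : Integrable g Γ.waitingLaw := by
    refine ⟨hgmeas.aestronglyMeasurable, ?_⟩
    rw [hasFiniteIntegral_iff_enorm, hnorm]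
    exact ENNReal.add_lt_top.2 ⟨enorm_lt_top, hden.2⟩
  refine ⟨hgint, ?_⟩
  have hpos := hpart (fun x => ENNReal.ofReal x) (by fun_prop) fun x a ha => by
    rw [ENNReal.ofReal_mul' ha]
  have hneg := hpart (fun x => ENNReal.ofReal (-x)) (by fun_prop) fun x a ha => by
    rw [← neg_mul, ENNReal.ofReal_mul' ha]
  have hden_neg : ∫⁻ s in Set.Ioc 0 t,
      ENNReal.ofReal (-(f s * (Γ.rate * Real.exp (-Γ.rate * s)))) ≠ ∞ :=
    hden.neg.lintegral_lt_top.ne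
  rw [integral_eq_lintegral_pos_part_sub_lintegral_neg_part hgint,
    integral_eq_lintegral_pos_part_sub_lintegral_neg_part hden, hpos, hneg,
    ENNReal.toReal_add ENNReal.ofReal_ne_top hden.lintegral_lt_top.ne,
    ENNReal.toReal_add ENNReal.ofReal_ne_top hden_neg,
    ENNReal.toReal_ofReal', ENNReal.toReal_ofReal']
  have := max_zero_sub_max_neg_zero_eq_self (c * Real.exp (-Γ.rate * t))
  linarith

end Arrivals

/-! ### Play and values under limited retaliation. -/

section LimitedRetaliation

variable (Γ : RevisionGame)

lemma measurable_u : Measurable fun p : Γ.A × Γ.A => Γ.u p.1 p.2 := Γ.continuous_u.measurable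

lemma measurable_u_diag {x : ℝ → Γ.A} (hx : Measurable x) :
    Measurable fun s => Γ.u (x s) (x s) :=
  Γ.measurable_u.comp (hx.prodMk hx)

lemma u_le_add_G (a b : Γ.A) : Γ.u a b ≤ Γ.u b b + Γ.G b := by
  obtain ⟨m, hm⟩ := Γ.exists_bestReply b
  have hbdd : BddAbove (Set.range fun c => Γ.u c b) := ⟨_, Set.forall_mem_range.2 hm⟩
  have := le_ciSup hbdd a
  unfold G
  linarith

lemma exists_G_eq (b : Γ.A) : ∃ m, Γ.G b = Γ.u m b - Γ.u b b := by
  obtain ⟨m, hm⟩ := Γ.exists_bestReply b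
  have : Nonempty Γ.A := ⟨b⟩
  refine ⟨m, ?_⟩
  unfold G
  rw [le_antisymm (ciSup_le hm) (le_ciSup (f := fun c => Γ.u c b) ⟨_, Set.forall_mem_range.2 hm⟩ m)]

section Retaliation

variable {Γ} {x : ℝ → Γ.A} {k : ℝ}

/-- For a fixed history the queried time enters only through lower bounds, the ends of phases. -/
lemma Retaliating.mono {h : Γ.History} {s s' : ℝ} (hr : Γ.Retaliating x k h s) (hs : s ≤ s') :
    Γ.Retaliating x k h s' := by
  induction h with
  | nil => exact hr
  | cons e h ih =>
    rcases hr with ⟨h1, h2⟩ | ⟨h1, h2, h3⟩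
    · exact Or.inl ⟨h1, ih h2⟩
    · exact Or.inr ⟨h1, h2, h3.trans hs⟩

lemma measurableSet_retaliating (h : Γ.History) : MeasurableSet {s | Γ.Retaliating x k h s} := by
  have : IsUpperSet {s | Γ.Retaliating x k h s} := fun _ _ hs hr => Retaliating.mono hr hs
  exact this.ordConnected.measurableSet

lemma measurableSet_retaliating_ofFn (hx : Measurable x) (n : ℕ) :
    MeasurableSet {p : (Fin n → ℝ × (Fin 2 → Γ.A)) × ℝ |
      Γ.Retaliating x k (List.ofFn p.1) p.2} := by
  induction n with
  | zero => simp [Retaliating]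
  | succ n ih =>
    have htail : Measurable fun p : (Fin (n + 1) → ℝ × (Fin 2 → Γ.A)) × ℝ =>
        fun i : Fin n => p.1 i.succ := by fun_prop
    have h1 : MeasurableSet {p : (Fin (n + 1) → ℝ × (Fin 2 → Γ.A)) × ℝ |
        Γ.Retaliating x k (List.ofFn fun i : Fin n => p.1 i.succ) (p.1 0).1} :=
      (htail.prodMk (by fun_prop)) ih
    have h2 : MeasurableSet {p : (Fin (n + 1) → ℝ × (Fin 2 → Γ.A)) × ℝ |
        Γ.Retaliating x k (List.ofFn fun i : Fin n => p.1 i.succ) p.2} :=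
      (htail.prodMk measurable_snd) ih
    have h3 : MeasurableSet {p : (Fin (n + 1) → ℝ × (Fin 2 → Γ.A)) × ℝ |
        ∃ i, (p.1 0).2 i ≠ x (p.1 0).1} := by
      have : {p : (Fin (n + 1) → ℝ × (Fin 2 → Γ.A)) × ℝ | ∃ i, (p.1 0).2 i ≠ x (p.1 0).1} =
          ⋃ i, {p : (Fin (n + 1) → ℝ × (Fin 2 → Γ.A)) × ℝ | (p.1 0).2 i = x (p.1 0).1}ᶜ := by
        ext p; simp
      rw [this]
      refine MeasurableSet.iUnion fun i => MeasurableSet.compl ?_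
      exact measurableSet_eq_fun (by fun_prop) (hx.comp (by fun_prop))
    have h4 : MeasurableSet {p : (Fin (n + 1) → ℝ × (Fin 2 → Γ.A)) × ℝ |
        (p.1 0).1 - k * (p.1 0).1 ≤ p.2} :=
      measurableSet_le (by fun_prop) (by fun_prop)
    refine ((h1.inter h2).union (h1.compl.inter (h3.inter h4))).congr ?_
    ext p
    rw [Set.mem_ofPred_eq, List.ofFn_succ, Retaliating]
    exact Iff.rfl

lemma isMeasurableStrategy_LR (hx : Measurable x) : Γ.IsMeasurableStrategy (Γ.LR x k) := fun n =>
  Measurable.ite (measurableSet_retaliating_ofFn hx n) measurable_const (hx.comp measurable_snd)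

/-- A choice inside a phase is ignored, and a conforming one outside starts none. In the latter case
no phase of `h` reaches the later date `s`, by `Retaliating.mono`. -/
lemma retaliating_choose_LR {h : Γ.History} {s t : ℝ} (hs : s ≤ t) :
    Γ.Retaliating x k (Γ.choose (Γ.LRProfile x k) h t) s ↔ Γ.Retaliating x k h s := by
  by_cases ht : Γ.Retaliating x k h t
  · simp [choose, Retaliating, ht]
  · have : ¬ Γ.Retaliating x k h s := fun h' => ht (h'.mono hs)
    simp [choose, Retaliating, ht, this, LRProfile, LR]

lemma retaliating_play_LR {h : Γ.History} {t : ℝ} {w : ℕ → ℝ} {s : ℝ} {n : ℕ}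
    (hs : ∀ m < n, s ≤ arrival t w m) :
    Γ.Retaliating x k (Γ.play (Γ.LRProfile x k) h t w n) s ↔ Γ.Retaliating x k h s := by
  induction n with
  | zero => rfl
  | succ n ih =>
    rw [play, retaliating_choose_LR (hs n n.lt_succ_self)]
    exact ih fun m hm => hs m (hm.trans n.lt_succ_self)

open Classical in
/-- The stage payoff from a choice at time `s` if everybody follows the limited retaliation
strategy after the history `h`. -/
noncomputable def pathPayoff (x : ℝ → Γ.A) (k : ℝ) (h : Γ.History) (s : ℝ) : ℝ :=
  if Γ.Retaliating x k h s then Γ.u Γ.aN Γ.aN else Γ.u (x s) (x s)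

lemma measurable_pathPayoff (hx : Measurable x) (h : Γ.History) :
    Measurable (pathPayoff x k h) :=
  Measurable.ite (measurableSet_retaliating h) measurable_const (Γ.measurable_u_diag hx)

lemma abs_pathPayoff_le (h : Γ.History) (s : ℝ) :
    |pathPayoff x k h s| ≤ |Γ.u Γ.aN Γ.aN| + |Γ.u (x s) (x s)| := by
  unfold pathPayoff
  split_ifs
  · exact le_add_of_nonneg_right (abs_nonneg _)
  · exact le_add_of_nonneg_left (abs_nonneg _)

lemma integrableOn_diag (hint : IntervalIntegrable (fun s => Γ.u (x s) (x s)) volume 0 Γ.T) {t : ℝ}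
    (ht : t ≤ Γ.T) : IntegrableOn (fun s => Γ.u (x s) (x s)) (Set.Ioc 0 t) :=
  ((intervalIntegrable_iff_integrableOn_Ioc_of_le Γ.T_pos.le).1 hint).mono_set
    (Set.Ioc_subset_Ioc_right ht)

lemma integrableOn_pathPayoff (hx : Measurable x)
    (hint : IntervalIntegrable (fun s => Γ.u (x s) (x s)) volume 0 Γ.T) (h : Γ.History) {t : ℝ}
    (ht : t ≤ Γ.T) : IntegrableOn (pathPayoff x k h) (Set.Ioc 0 t) := by
  refine Integrable.mono' (g := fun s => |Γ.u Γ.aN Γ.aN| + |Γ.u (x s) (x s)|)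
    ((integrableOn_const (by simp)).add (integrableOn_diag hint ht).abs)
    (measurable_pathPayoff hx h).aestronglyMeasurable (ae_of_all _ fun s => abs_pathPayoff_le h s)

lemma realizedPayoff_LR (i : Fin 2) (e : ℝ × (Fin 2 → Γ.A)) (h : Γ.History) (t : ℝ) {w : ℕ → ℝ}
    (hw : ∀ n, 0 ≤ w n) :
    Γ.realizedPayoff (Γ.LRProfile x k) i (e :: h) t w =
      if numArrivals t w = 0 then Γ.u (e.2 i) (e.2 i.rev)
      else pathPayoff x k (e :: h) (arrival t w (numArrivals t w - 1)) := by
  unfold realizedPayoff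
  rcases hN : numArrivals t w with _ | n
  · rfl
  · have hret : Γ.Retaliating x k (Γ.play (Γ.LRProfile x k) (e :: h) t w n) (arrival t w n) ↔
        Γ.Retaliating x k (e :: h) (arrival t w n) :=
      retaliating_play_LR fun m hm => arrival_antitone t hw hm.le
    rw [if_neg (Nat.succ_ne_zero n), Nat.add_sub_cancel]
    simp only [play, choose, finalPayoff, LRProfile, LR, pathPayoff]
    by_cases hr : Γ.Retaliating x k (e :: h) (arrival t w n)
    · simp [hret.2 hr, hr]
    · simp [hret.not.2 hr, hr]

/-- The expected payoff from the limited retaliation profile if the profile `b` is in place. -/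
noncomputable def pathValue (x : ℝ → Γ.A) (k : ℝ) (i : Fin 2) (b : Fin 2 → Γ.A) (h : Γ.History)
    (t : ℝ) : ℝ :=
  Γ.u (b i) (b i.rev) * Real.exp (-Γ.rate * t) +
    ∫ s in Set.Ioc 0 t, pathPayoff x k h s * (Γ.rate * Real.exp (-Γ.rate * s))

lemma integral_realizedPayoff_LR (hx : Measurable x)
    (hint : IntervalIntegrable (fun s => Γ.u (x s) (x s)) volume 0 Γ.T) (i : Fin 2)
    (e : ℝ × (Fin 2 → Γ.A)) (h : Γ.History) {t : ℝ} (h0 : 0 ≤ t) (ht : t ≤ Γ.T) :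
    Integrable (Γ.realizedPayoff (Γ.LRProfile x k) i (e :: h) t) Γ.waitingLaw ∧
      ∫ w, Γ.realizedPayoff (Γ.LRProfile x k) i (e :: h) t w ∂Γ.waitingLaw =
        pathValue x k i e.2 (e :: h) t := by
  have hae : Γ.realizedPayoff (Γ.LRProfile x k) i (e :: h) t =ᵐ[Γ.waitingLaw]
      fun w => if numArrivals t w = 0 then Γ.u (e.2 i) (e.2 i.rev)
      else pathPayoff x k (e :: h) (arrival t w (numArrivals t w - 1)) := by
    filter_upwards [Γ.ae_waiting_nonneg] with w hw using realizedPayoff_LR i e h t hw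
  have := Γ.integrable_last_arrival h0 (Γ.u (e.2 i) (e.2 i.rev)) (measurable_pathPayoff hx (e :: h))
    (integrableOn_pathPayoff (k := k) hx hint (e :: h) ht)
  exact ⟨this.1.congr hae.symm, (integral_congr_ae hae).trans this.2⟩

lemma expectedPayoff_of_integrable {σ : Γ.Profile} {i : Fin 2} {h : Γ.History} {t : ℝ}
    (hi : Integrable (Γ.realizedPayoff σ i h t) Γ.waitingLaw) :
    Γ.expectedPayoff σ i h t = ((∫ w, Γ.realizedPayoff σ i h t w ∂Γ.waitingLaw : ℝ) : EReal) := by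
  rw [integral_eq_lintegral_pos_part_sub_lintegral_neg_part hi, EReal.coe_sub,
    EReal.coe_ennreal_toReal hi.lintegral_lt_top.ne, EReal.coe_ennreal_toReal]
  · rfl
  · exact hi.neg.lintegral_lt_top.ne

/-- The two continuation paths agree except on the phase triggered at `t`, where the deviator's path
yields the Nash payoff; the deviating profile itself counts only if no revision follows. -/
lemma pathValue_sub_of_deviation (hx : Measurable x)
    (hint : IntervalIntegrable (fun s => Γ.u (x s) (x s)) volume 0 Γ.T) (hk : k ∈ Set.Ioo (0 : ℝ) 1)
    {i : Fin 2} {h : Γ.History} {t : ℝ} (h0 : 0 ≤ t) (ht : t ≤ Γ.T)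
    (hr : ¬ Γ.Retaliating x k h t) {b : Fin 2 → Γ.A} (hb : b i ≠ x t) (hb' : b i.rev = x t) :
    pathValue x k i (fun _ => x t) ((t, fun _ => x t) :: h) t - pathValue x k i b ((t, b) :: h) t =
      (∫ s in (t - k * t)..t, Γ.L (x s) * (Γ.rate * Real.exp (-Γ.rate * s))) -
        (Γ.u (b i) (x t) - Γ.u (x t) (x t)) * Real.exp (-Γ.rate * t) := by
  have hden : ∀ h' : Γ.History, IntegrableOn
      (fun s => pathPayoff x k h' s * (Γ.rate * Real.exp (-Γ.rate * s))) (Set.Ioc 0 t) := by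
    intro h'
    have := integrableOn_pathPayoff (k := k) hx hint h' ht
    rw [← integrableOn_Icc_iff_integrableOn_Ioc] at this ⊢
    exact this.mul_continuousOn (by fun_prop) isCompact_Icc
  have hkt : 0 ≤ t - k * t := by nlinarith [hk.2]
  have hkt' : t - k * t ≤ t := by nlinarith [hk.1]
  have key : (∫ s in (t - k * t)..t, Γ.L (x s) * (Γ.rate * Real.exp (-Γ.rate * s))) =
      (∫ s in Set.Ioc 0 t, pathPayoff x k ((t, fun _ => x t) :: h) s *
        (Γ.rate * Real.exp (-Γ.rate * s))) -
      ∫ s in Set.Ioc 0 t, pathPayoff x k ((t, b) :: h) s *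
        (Γ.rate * Real.exp (-Γ.rate * s)) := by
    rw [← integral_sub (hden _) (hden _), intervalIntegral.integral_of_le hkt']
    have hset : Set.Ioc (t - k * t) t = Set.Ioc 0 t ∩ Set.Ioi (t - k * t) := by
      ext s; simp only [Set.mem_Ioc, Set.mem_inter_iff, Set.mem_Ioi]
      constructor
      · rintro ⟨h1, h2⟩; exact ⟨⟨hkt.trans_lt h1, h2⟩, h1⟩
      · rintro ⟨⟨h1, h2⟩, h3⟩; exact ⟨h3, h2⟩
    -- The phase includes its endpoint `t - k * t`, the interval integral does not; this is a null
    -- set.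
    rw [hset, setIntegral_congr_set ((ae_eq_refl _).inter Ioi_ae_eq_Ici),
      ← setIntegral_indicator measurableSet_Ici]
    refine setIntegral_congr_fun measurableSet_Ioc fun s _ => ?_
    have hex : ∃ j, b j ≠ x t := ⟨i, hb⟩
    by_cases hs : t - k * t ≤ s
    · have hs' : t ≤ s + k * t := by linarith
      simp [Set.indicator, pathPayoff, Retaliating, hr, hs', hex, L]
      ring
    · have hs' : ¬ t ≤ s + k * t := by linarith
      simp [Set.indicator, pathPayoff, Retaliating, hr, hs']
  rw [key]
  unfold pathValue
  rw [hb']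
  ring

end Retaliation

end LimitedRetaliation

/-! ### The one-shot deviation principle. -/

section OneShotDeviation

variable {Γ : RevisionGame}

lemma rev_ne_self (i : Fin 2) : i.rev ≠ i := by revert i; decide

lemma length_play (σ : Γ.Profile) (h : Γ.History) (t : ℝ) (w : ℕ → ℝ) (n : ℕ) :
    (Γ.play σ h t w n).length = h.length + n := by
  induction n with
  | zero => rfl
  | succ n ih => rw [play, choose, List.length_cons, ih]; rfl

/-- Each choice lengthens the history by one, so length serves as a clock for when a strategy is
consulted. -/
lemma play_congr {σ σ' : Γ.Profile} {h : Γ.History} {t : ℝ} {w : ℕ → ℝ} {n : ℕ}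
    (hσ : ∀ g s i, h.length ≤ g.length → g.length < h.length + n → σ i g s = σ' i g s) :
    Γ.play σ h t w n = Γ.play σ' h t w n := by
  induction n with
  | zero => rfl
  | succ n ih =>
    rw [play, play, ih fun g s i h1 h2 => hσ g s i h1 (h2.trans (Nat.lt_succ_self _))]
    unfold choose
    congr 2
    funext i
    exact hσ _ _ i (by rw [length_play]; omega) (by rw [length_play]; omega)

lemma play_splice_of_le (σ : Γ.Profile) (h : Γ.History) (t : ℝ) (w v : ℕ → ℝ) {j n : ℕ}
    (hn : n ≤ j + 1) : Γ.play σ h t (splice j w v) n = Γ.play σ h t w n := by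
  induction n with
  | zero => rfl
  | succ n ih => rw [play, play, ih (by omega), arrival_splice_of_le t (by omega)]

lemma play_splice_add (σ : Γ.Profile) (h : Γ.History) (t : ℝ) (w v : ℕ → ℝ) (j n : ℕ) :
    Γ.play σ h t (splice j w v) (j + 1 + n) =
      Γ.play σ (Γ.play σ h t w (j + 1)) (arrival t w j) v n := by
  induction n with
  | zero => exact play_splice_of_le σ h t w v le_rfl
  | succ n ih => rw [← add_assoc, play, ih, arrival_splice_add]; rfl

lemma realizedPayoff_splice (σ : Γ.Profile) (i : Fin 2) (h : Γ.History) {t : ℝ} {j : ℕ}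
    {w v : ℕ → ℝ} (hw : ∀ n, 0 ≤ w n) (hj : 0 ≤ arrival t w j)
    (hfin : ∃ n, arrival (arrival t w j) v n < 0) :
    Γ.realizedPayoff σ i h t (splice j w v) =
      Γ.realizedPayoff σ i (Γ.play σ h t w (j + 1)) (arrival t w j) v := by
  unfold realizedPayoff
  rw [numArrivals_splice hw hj hfin, play_splice_add]

/-- Measurability of strategies is stated on tuples, so the random history is written as a tuple of
its deterministic length. -/
lemma exists_measurable_play {σ : Γ.Profile} (hσ : ∀ i, Γ.IsMeasurableStrategy (σ i))
    (h : Γ.History) (t : ℝ) (n : ℕ) :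
    ∃ P : (ℕ → ℝ) → Fin (h.length + n) → ℝ × (Fin 2 → Γ.A), Measurable P ∧
      ∀ w, Γ.play σ h t w n = List.ofFn (P w) := by
  induction n with
  | zero => exact ⟨fun _ => h.get, measurable_const, fun w => (List.ofFn_get h).symm⟩
  | succ n ih =>
    obtain ⟨P, hP, hPlay⟩ := ih
    refine ⟨fun w => Fin.cons (arrival t w n, fun i => σ i (List.ofFn (P w)) (arrival t w n)) (P w),
      ?_, fun w => ?_⟩
    · refine measurable_pi_lambda _ fun m => ?_
      refine Fin.cases ?_ (fun m => ?_) m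
      · simp only [Fin.cons_zero]
        exact (measurable_arrival t n).prodMk (measurable_pi_lambda _ fun i =>
          (hσ i _).comp (hP.prodMk (measurable_arrival t n)))
      · simp only [Fin.cons_succ]
        exact (measurable_pi_apply m).comp hP
    · rw [play, choose, hPlay]
      exact (List.ofFn_cons _ _).symm

lemma measurable_finalPayoff_play {σ : Γ.Profile} (hσ : ∀ i, Γ.IsMeasurableStrategy (σ i))
    (i : Fin 2) (h : Γ.History) (t : ℝ) (n : ℕ) :
    Measurable fun w => Γ.finalPayoff i (Γ.play σ h t w n) := by
  cases n with
  | zero => exact measurable_const (a := Γ.finalPayoff i h)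
  | succ n =>
    obtain ⟨P, hP, hPlay⟩ := exists_measurable_play hσ h t n
    have hact : ∀ j, Measurable fun w => σ j (Γ.play σ h t w n) (arrival t w n) := fun j => by
      simp_rw [hPlay]
      exact (hσ j _).comp (hP.prodMk (measurable_arrival t n))
    exact Γ.measurable_u.comp ((hact i).prodMk (hact i.rev))

lemma measurable_realizedPayoff {σ : Γ.Profile} (hσ : ∀ i, Γ.IsMeasurableStrategy (σ i))
    (i : Fin 2) (h : Γ.History) (t : ℝ) : Measurable (Γ.realizedPayoff σ i h t) :=
  (measurable_from_prod_countable_left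
    (f := fun p : (ℕ → ℝ) × ℕ => Γ.finalPayoff i (Γ.play σ h t p.1 p.2))
    fun n => measurable_finalPayoff_play hσ i h t n).comp
      (measurable_id.prodMk (measurable_numArrivals t))

lemma isMeasurableStrategy_of_length {σ τ : Γ.Strategy} (hσ : Γ.IsMeasurableStrategy σ)
    (hτ : Γ.IsMeasurableStrategy τ) (p : ℕ → Prop) [DecidablePred p] :
    Γ.IsMeasurableStrategy fun h t => if p h.length then τ h t else σ h t := by
  intro n
  simp only [List.length_ofFn]
  by_cases hn : p n
  · simpa only [hn, if_true] using hτ n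
  · simpa only [hn, if_false] using hσ n

lemma isMeasurableStrategy_update {σ : Γ.Profile} (hσ : ∀ i, Γ.IsMeasurableStrategy (σ i))
    (i : Fin 2) {τ : Γ.Strategy} (hτ : Γ.IsMeasurableStrategy τ) (j : Fin 2) :
    Γ.IsMeasurableStrategy (Function.update σ i τ j) := by
  by_cases hj : j = i
  · subst hj; rwa [Function.update_self]
  · rw [Function.update_of_ne hj]; exact hσ j

/-- Follow `τ` as long as fewer than `n` choices were made before, and `σ` from then on. -/
def followUntil (n : ℕ) (τ σ : Γ.Strategy) : Γ.Strategy := fun h t =>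
  if h.length < n then τ h t else σ h t

lemma update_followUntil_of_lt {σ : Γ.Profile} (i : Fin 2) (τ : Γ.Strategy) {n : ℕ} (j : Fin 2)
    {g : Γ.History} (hg : g.length < n) (s : ℝ) :
    Function.update σ i (followUntil n τ (σ i)) j g s = Function.update σ i τ j g s := by
  by_cases hj : j = i
  · subst hj; simp [followUntil, hg]
  · simp [Function.update_of_ne hj]

lemma update_followUntil_of_le {σ : Γ.Profile} (i : Fin 2) (τ : Γ.Strategy) {n : ℕ} (j : Fin 2)
    {g : Γ.History} (hg : n ≤ g.length) (s : ℝ) :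
    Function.update σ i (followUntil n τ (σ i)) j g s = σ j g s := by
  by_cases hj : j = i
  · subst hj; simp [followUntil, not_lt.2 hg]
  · simp [Function.update_of_ne hj]

lemma realizedPayoff_congr {σ σ' : Γ.Profile} (i : Fin 2) {h : Γ.History} (t : ℝ) (w : ℕ → ℝ)
    (hσ : ∀ g s j, h.length ≤ g.length → g.length < h.length + numArrivals t w →
      σ j g s = σ' j g s) :
    Γ.realizedPayoff σ i h t w = Γ.realizedPayoff σ' i h t w := by
  unfold realizedPayoff
  rw [play_congr hσ]

/-- Deviating once and then returning to the profile `σ` does not pay at time `s` after any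
history, whatever the own action. -/
def OneShotOptimal (σ : Γ.Profile) : Prop :=
  ∀ (i : Fin 2) (h : Γ.History) (s : ℝ) (b : Fin 2 → Γ.A), 0 ≤ s → s ≤ Γ.T →
    b i.rev = σ i.rev h s →
    ∫ w, Γ.realizedPayoff σ i ((s, b) :: h) s w ∂Γ.waitingLaw ≤
      ∫ w, Γ.realizedPayoff σ i (Γ.choose σ h s) s w ∂Γ.waitingLaw

/-- The two hybrids differ only in the choice at arrival `j`, and both follow `σ` afterwards.
Conditioning on the waiting times up to that arrival reduces the comparison to `OneShotOptimal`. -/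
lemma integral_followUntil_succ_le {σ : Γ.Profile} (hopt : OneShotOptimal σ)
    (hintegrable : ∀ (i : Fin 2) e (h : Γ.History) t, 0 ≤ t → t ≤ Γ.T →
      Integrable (Γ.realizedPayoff σ i (e :: h) t) Γ.waitingLaw)
    (i : Fin 2) {τ : Γ.Strategy} (h : Γ.History) {t : ℝ} (ht : t ≤ Γ.T) (j : ℕ)
    (h1 : Integrable (Γ.realizedPayoff (Function.update σ i
      (followUntil (h.length + j + 1) τ (σ i))) i h t) Γ.waitingLaw)
    (h2 : Integrable (Γ.realizedPayoff (Function.update σ i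
      (followUntil (h.length + j) τ (σ i))) i h t) Γ.waitingLaw) :
    ∫ w, Γ.realizedPayoff (Function.update σ i
      (followUntil (h.length + j + 1) τ (σ i))) i h t w ∂Γ.waitingLaw ≤
    ∫ w, Γ.realizedPayoff (Function.update σ i
      (followUntil (h.length + j) τ (σ i))) i h t w ∂Γ.waitingLaw := by
  set σ1 := Function.update σ i (followUntil (h.length + j + 1) τ (σ i)) with hσ1
  set σ2 := Function.update σ i (followUntil (h.length + j) τ (σ i)) with hσ2
  rw [← sub_nonpos, ← integral_sub h1 h2, ← (Γ.measurePreserving_splice j).map_eq,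
    integral_map (measurable_splice j).aemeasurable
      (by rw [(Γ.measurePreserving_splice j).map_eq]; exact (h1.sub h2).aestronglyMeasurable),
    integral_prod (fun p : (ℕ → ℝ) × (ℕ → ℝ) => Γ.realizedPayoff σ1 i h t (splice j p.1 p.2) -
      Γ.realizedPayoff σ2 i h t (splice j p.1 p.2))
      ((Γ.measurePreserving_splice j).integrable_comp_of_integrable (h1.sub h2))]
  refine integral_nonpos_of_ae ?_
  filter_upwards [Γ.ae_waiting_nonneg] with w hw
  by_cases hj : 0 ≤ arrival t w j
  · have hplay : Γ.play σ1 h t w j = Γ.play σ2 h t w j := play_congr fun g s l _ hg => by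
      rw [hσ1, hσ2, update_followUntil_of_lt i τ l hg,
        update_followUntil_of_lt i τ l (hg.trans (Nat.lt_succ_self _))]
    have hlen : (Γ.play σ2 h t w j).length = h.length + j := length_play _ _ _ _ _
    set g := Γ.play σ2 h t w j with hg
    set s := arrival t w j with hs
    have hsT : s ≤ Γ.T := (arrival_le t hw j).trans ht
    have e1 : ∀ᵐ v ∂Γ.waitingLaw, Γ.realizedPayoff σ1 i h t (splice j w v) =
        Γ.realizedPayoff σ i (Γ.choose σ1 g s) s v := by
      filter_upwards [Γ.ae_exists_arrival_neg s] with v hv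
      rw [realizedPayoff_splice σ1 i h hw hj hv, play, hplay]
      refine realizedPayoff_congr i _ _ fun g' s' l hg' _ => ?_
      exact update_followUntil_of_le i τ l (by
        simp only [choose, List.length_cons, hlen] at hg'; omega) s'
    have e2 : ∀ᵐ v ∂Γ.waitingLaw, Γ.realizedPayoff σ2 i h t (splice j w v) =
        Γ.realizedPayoff σ i (Γ.choose σ g s) s v := by
      filter_upwards [Γ.ae_exists_arrival_neg s] with v hv
      rw [realizedPayoff_splice σ2 i h hw hj hv, play]
      have : Γ.choose σ2 g s = Γ.choose σ g s := by
        unfold choose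
        congr 2
        funext l
        exact update_followUntil_of_le i τ l hlen.ge s
      rw [← hg, ← hs, this]
      refine realizedPayoff_congr i _ _ fun g' s' l hg' _ => ?_
      exact update_followUntil_of_le i τ l (by
        simp only [choose, List.length_cons, hlen] at hg'; omega) s'
    have e3 : (fun v => Γ.realizedPayoff σ1 i h t (splice j w v) -
        Γ.realizedPayoff σ2 i h t (splice j w v)) =ᵐ[Γ.waitingLaw]
        fun v => Γ.realizedPayoff σ i (Γ.choose σ1 g s) s v -
          Γ.realizedPayoff σ i (Γ.choose σ g s) s v := by
      filter_upwards [e1, e2] with v h1 h2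
      rw [h1, h2]
    calc _ = _ := integral_congr_ae e3
      _ = _ := integral_sub (hintegrable _ _ _ _ hj hsT) (hintegrable _ _ _ _ hj hsT)
      _ ≤ 0 := sub_nonpos.2 (hopt i g s _ hj hsT (by
        simp only [hσ1, Function.update_of_ne (rev_ne_self i)]))
  -- Arrival `j` misses the deadline, so the choice in which the hybrids differ is never made.
  · refine le_of_eq (integral_eq_zero_of_ae ?_)
    filter_upwards with v
    refine sub_eq_zero.2 (realizedPayoff_congr i t _ fun g s l _ hg => ?_)
    have hN : numArrivals t (splice j w v) ≤ j := Nat.sInf_le (by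
      change arrival t (splice j w v) j < 0
      rw [arrival_splice_of_le t le_rfl]; exact not_le.1 hj)
    rw [hσ1, hσ2, update_followUntil_of_lt i τ l (by omega),
      update_followUntil_of_lt i τ l (by omega)]

/-- The one-shot deviation principle for revision games, for deviations whose payoff is bounded
above by an integrable function. -/
lemma expectedPayoff_update_le {σ : Γ.Profile} (hσ : ∀ i, Γ.IsMeasurableStrategy (σ i))
    (hopt : OneShotOptimal σ)
    (hintegrable : ∀ (i : Fin 2) e (h : Γ.History) t, 0 ≤ t → t ≤ Γ.T →
      Integrable (Γ.realizedPayoff σ i (e :: h) t) Γ.waitingLaw)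
    (i : Fin 2) {τ : Γ.Strategy} (hτ : Γ.IsMeasurableStrategy τ) (e : ℝ × (Fin 2 → Γ.A))
    (h : Γ.History) {t : ℝ} (h0 : 0 ≤ t) (ht : t ≤ Γ.T)
    {F H : (ℕ → ℝ) → ℝ} (hF : Integrable F Γ.waitingLaw) (hH : Integrable H Γ.waitingLaw)
    (hτF : ∀ᵐ w ∂Γ.waitingLaw,
      Γ.realizedPayoff (Function.update σ i τ) i (e :: h) t w ≤ F w)
    (hH' : ∀ n, ∀ᵐ w ∂Γ.waitingLaw, n < numArrivals t w →
      |Γ.realizedPayoff (Function.update σ i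
        (followUntil ((e :: h).length + n) τ (σ i))) i (e :: h) t w| ≤ H w) :
    Γ.expectedPayoff (Function.update σ i τ) i (e :: h) t ≤ Γ.expectedPayoff σ i (e :: h) t := by
  set g := e :: h with hg
  set D := Γ.realizedPayoff (Function.update σ i τ) i g t with hD
  have hDmeas : Measurable D :=
    measurable_realizedPayoff (isMeasurableStrategy_update hσ i hτ) i g t
  -- An infinite negative part makes the deviation worth `⊥`; otherwise the upper bound `F` makes
  -- `D` integrable.
  by_cases hneg : ∫⁻ w, ENNReal.ofReal (-D w) ∂Γ.waitingLaw = ∞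
  · have : Γ.expectedPayoff (Function.update σ i τ) i g t = ⊥ := by
      unfold expectedPayoff
      rw [← hD, hneg, EReal.coe_ennreal_top, EReal.sub_top]
    rw [this]
    exact bot_le
  set Dn : ℕ → (ℕ → ℝ) → ℝ := fun n => Γ.realizedPayoff (Function.update σ i
    (followUntil (g.length + n) τ (σ i))) i g t with hDn
  have hDnmeas : ∀ n, Measurable (Dn n) := fun n =>
    measurable_realizedPayoff (isMeasurableStrategy_update hσ i
      (isMeasurableStrategy_of_length (hσ i) hτ (· < g.length + n))) i g t
  have hDint : Integrable D Γ.waitingLaw := by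
    have hpos : ∫⁻ w, ENNReal.ofReal (D w) ∂Γ.waitingLaw < ∞ :=
      (lintegral_mono_ae (hτF.mono fun w hw => ENNReal.ofReal_le_ofReal hw)).trans_lt
        hF.lintegral_lt_top
    refine ⟨hDmeas.aestronglyMeasurable, ?_⟩
    rw [hasFiniteIntegral_iff_norm]
    have : ∀ w, ENNReal.ofReal ‖D w‖ = ENNReal.ofReal (D w) + ENNReal.ofReal (-D w) := by
      intro w
      rcases le_total 0 (D w) with h | h
      · rw [Real.norm_of_nonneg h, ENNReal.ofReal_of_nonpos (neg_nonpos.2 h), add_zero]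
      · rw [Real.norm_of_nonpos h, ENNReal.ofReal_of_nonpos h, zero_add]
    simp_rw [this]
    rw [lintegral_add_left (by fun_prop)]
    exact ENNReal.add_lt_top.2 ⟨hpos, lt_top_iff_ne_top.2 hneg⟩
  have hagree : ∀ n w, numArrivals t w ≤ n → Dn n w = D w := fun n w hn =>
    realizedPayoff_congr i t w fun g' s l _ hg' =>
      update_followUntil_of_lt i τ l (by omega) s
  -- Either the hybrid never returns to `σ` before the deadline and equals `D`, or its last choice
  -- is made under `σ` and `H` bounds it.
  have hbound : ∀ n, ∀ᵐ w ∂Γ.waitingLaw, ‖Dn n w‖ ≤ |D w| + |H w| := by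
    intro n
    filter_upwards [hH' n] with w hw
    by_cases hn : n < numArrivals t w
    · exact ((hw hn).trans (le_abs_self _)).trans (le_add_of_nonneg_left (abs_nonneg _))
    · rw [hagree n w (not_lt.1 hn)]
      exact le_add_of_nonneg_right (abs_nonneg _)
  have hdom : Integrable (fun w => |D w| + |H w|) Γ.waitingLaw := hDint.abs.add hH.abs
  have hDnint : ∀ n, Integrable (Dn n) Γ.waitingLaw := fun n =>
    hdom.mono' (hDnmeas n).aestronglyMeasurable (hbound n)
  have hanti : Antitone fun n => ∫ w, Dn n w ∂Γ.waitingLaw := antitone_nat_of_succ_le fun n =>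
    integral_followUntil_succ_le hopt hintegrable i g ht n (hDnint (n + 1)) (hDnint n)
  have hlim : Tendsto (fun n => ∫ w, Dn n w ∂Γ.waitingLaw) atTop (𝓝 (∫ w, D w ∂Γ.waitingLaw)) :=
    tendsto_integral_of_dominated_convergence _ (fun n => (hDnmeas n).aestronglyMeasurable) hdom
      hbound (ae_of_all _ fun w => tendsto_atTop_of_eventually_const (i₀ := numArrivals t w)
        fun n hn => hagree n w hn)
  have h00 : Dn 0 = Γ.realizedPayoff σ i g t := by
    funext w
    exact realizedPayoff_congr i t w fun g' s l hg' _ => update_followUntil_of_le i τ l hg' s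
  rw [expectedPayoff_of_integrable hDint, expectedPayoff_of_integrable (hintegrable i e h t h0 ht),
    EReal.coe_le_coe_iff, ← h00]
  exact hanti.le_of_tendsto hlim 0

end OneShotDeviation

/-! ### The constraint and subgame perfection. -/

section Equilibrium

variable {Γ : RevisionGame} {x : ℝ → Γ.A} {k : ℝ}

lemma eq_or_eq_rev (i j : Fin 2) : j = i ∨ j = i.rev := by revert i j; decide

/-- The constraint under which limited retaliation deters all deviations at time `t`. -/
def SPEConstraint (x : ℝ → Γ.A) (k t : ℝ) : Prop :=
  Γ.G (x t) * Real.exp (-Γ.rate * t) ≤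
    ∫ s in (t - k * t)..t, Γ.L (x s) * (Γ.rate * Real.exp (-Γ.rate * s))

/-- Inside a phase the action has no later effect and the opponent plays `aN`, so the Nash property
suffices; outside, the constraint covers the largest possible gain. -/
lemma oneShotOptimal_LRProfile (hx : Measurable x)
    (hint : IntervalIntegrable (fun s => Γ.u (x s) (x s)) volume 0 Γ.T) (hk : k ∈ Set.Ioo (0 : ℝ) 1)
    (hc : ∀ t ∈ Set.Icc (0 : ℝ) Γ.T, SPEConstraint x k t) : OneShotOptimal (Γ.LRProfile x k) := by
  intro i h s b h0 hT hb
  rw [choose, (integral_realizedPayoff_LR hx hint i _ h h0 hT).2,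
    (integral_realizedPayoff_LR hx hint i _ h h0 hT).2]
  by_cases hr : Γ.Retaliating x k h s
  · have hpath : ∀ b : Fin 2 → Γ.A, ∀ r ∈ Set.Ioc 0 s,
        pathPayoff x k ((s, b) :: h) r * (Γ.rate * Real.exp (-Γ.rate * r)) =
        pathPayoff x k h r * (Γ.rate * Real.exp (-Γ.rate * r)) := fun b r _ => by
      have hret : Γ.Retaliating x k ((s, b) :: h) r ↔ Γ.Retaliating x k h r := by
        simp [Retaliating, hr]
      unfold pathPayoff
      by_cases hr' : Γ.Retaliating x k h r
      · rw [if_pos (hret.2 hr'), if_pos hr']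
      · rw [if_neg (hret.not.2 hr'), if_neg hr']
    unfold pathValue
    rw [setIntegral_congr_fun measurableSet_Ioc (hpath _),
      setIntegral_congr_fun measurableSet_Ioc (hpath _)]
    simp only [LRProfile, LR, hr, if_true] at hb ⊢
    rw [hb]
    gcongr
    exact Γ.nash _
  · have hconf : (fun i => Γ.LRProfile x k i h s) = fun _ => x s := by
      funext i; simp [LRProfile, LR, hr]
    have hb' : b i.rev = x s := hb.trans (congrFun hconf i.rev)
    rw [hconf]
    by_cases hdev : b i = x s
    · have : b = fun _ => x s := by
        funext j
        rcases eq_or_eq_rev i j with rfl | rfl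
        · exact hdev
        · exact hb'
      rw [this]
    · have hsub := pathValue_sub_of_deviation hx hint hk h0 hT hr hdev hb'
      have hcs := hc s ⟨h0, hT⟩
      unfold SPEConstraint at hcs
      have hG : (Γ.u (b i) (x s) - Γ.u (x s) (x s)) * Real.exp (-Γ.rate * s) ≤
          Γ.G (x s) * Real.exp (-Γ.rate * s) := by
        gcongr
        linarith [Γ.u_le_add_G (b i) (x s)]
      simp only
      linarith

/-- The right side of the constraint is at most the integral of its absolute integrand over all of
`(0, T]`, and `exp (rate * T)` absorbs the discounting on the left. This replaces boundedness of the
plan when deviation payoffs are dominated. -/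
lemma bddAbove_G_of_constraint
    (hint : IntervalIntegrable (fun s => Γ.u (x s) (x s)) volume 0 Γ.T) (hk : k ∈ Set.Ioo (0 : ℝ) 1)
    (hc : ∀ t ∈ Set.Icc (0 : ℝ) Γ.T, SPEConstraint x k t) :
    ∃ C, ∀ t ∈ Set.Icc (0 : ℝ) Γ.T, Γ.G (x t) ≤ C := by
  set f : ℝ → ℝ := fun s => Γ.L (x s) * (Γ.rate * Real.exp (-Γ.rate * s)) with hf
  have hfint : IntegrableOn f (Set.Ioc 0 Γ.T) := by
    have hL : IntegrableOn (fun s => Γ.L (x s)) (Set.Ioc 0 Γ.T) :=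
      (integrableOn_diag hint le_rfl).sub (integrableOn_const (by simp))
    rw [← integrableOn_Icc_iff_integrableOn_Ioc] at hL ⊢
    exact hL.mul_continuousOn (by fun_prop) isCompact_Icc
  refine ⟨(∫ s in Set.Ioc 0 Γ.T, |f s|) * Real.exp (Γ.rate * Γ.T), fun t ht => ?_⟩
  have hkt : 0 ≤ t - k * t := by nlinarith [hk.2, ht.1]
  have hkt' : t - k * t ≤ t := by nlinarith [hk.1, ht.1]
  have h1 : ∫ s in (t - k * t)..t, f s ≤ ∫ s in Set.Ioc 0 Γ.T, |f s| := by
    rw [intervalIntegral.integral_of_le hkt']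
    have hsub : Set.Ioc (t - k * t) t ⊆ Set.Ioc 0 Γ.T := Set.Ioc_subset_Ioc hkt ht.2
    calc ∫ s in Set.Ioc (t - k * t) t, f s ≤ ∫ s in Set.Ioc (t - k * t) t, |f s| :=
          integral_mono (hfint.mono_set hsub) (hfint.mono_set hsub).abs fun s => le_abs_self _
      _ ≤ _ := setIntegral_mono_set hfint.abs (ae_of_all _ fun s => abs_nonneg _)
          hsub.eventuallyLE
  have h2 : Γ.G (x t) * Real.exp (-Γ.rate * t) ≤ ∫ s in Set.Ioc 0 Γ.T, |f s| := (hc t ht).trans h1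
  have hexp : Real.exp (-Γ.rate * t) * Real.exp (Γ.rate * t) = 1 := by
    rw [← Real.exp_add]; simp
  calc Γ.G (x t) = Γ.G (x t) * Real.exp (-Γ.rate * t) * Real.exp (Γ.rate * t) := by
        rw [mul_assoc, hexp, mul_one]
    _ ≤ (∫ s in Set.Ioc 0 Γ.T, |f s|) * Real.exp (Γ.rate * t) := by gcongr
    _ ≤ _ := by
        have hrT : Γ.rate * t ≤ Γ.rate * Γ.T := mul_le_mul_of_nonneg_left ht.2 Γ.rate_pos.le
        have : 0 ≤ ∫ s in Set.Ioc 0 Γ.T, |f s| := integral_nonneg fun s => abs_nonneg _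
        gcongr

lemma isMeasurableStrategy_LRProfile (hx : Measurable x) (i : Fin 2) :
    Γ.IsMeasurableStrategy (Γ.LRProfile x k i) :=
  isMeasurableStrategy_LR hx

lemma finalPayoff_deviation_le (σ : Γ.Profile) (i : Fin 2) (h : Γ.History) (s : ℝ)
    (hσ : σ i.rev = Γ.LR x k) {C : ℝ} (hC : Γ.G (x s) ≤ C) :
    Γ.finalPayoff i (Γ.choose σ h s) ≤ |Γ.u Γ.aN Γ.aN| + (|Γ.u (x s) (x s)| + |C|) := by
  simp only [finalPayoff, choose, hσ, LR]
  have h1 := le_abs_self (Γ.u Γ.aN Γ.aN)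
  have h2 := le_abs_self (Γ.u (x s) (x s))
  have h3 := le_abs_self C
  have h4 := abs_nonneg (Γ.u Γ.aN Γ.aN)
  have h5 := abs_nonneg (Γ.u (x s) (x s))
  have h6 := abs_nonneg C
  split_ifs
  · linarith [Γ.nash (σ i h s)]
  · linarith [Γ.u_le_add_G (σ i h s) (x s)]

lemma abs_u_LR_le (h : Γ.History) (s : ℝ) :
    |Γ.u (Γ.LR x k h s) (Γ.LR x k h s)| ≤ |Γ.u Γ.aN Γ.aN| + |Γ.u (x s) (x s)| := by
  unfold LR
  split_ifs
  · exact le_add_of_nonneg_right (abs_nonneg _)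
  · exact le_add_of_nonneg_left (abs_nonneg _)

lemma expectedPayoff_update_LR_le (hx : Measurable x)
    (hint : IntervalIntegrable (fun s => Γ.u (x s) (x s)) volume 0 Γ.T) (hk : k ∈ Set.Ioo (0 : ℝ) 1)
    (hc : ∀ t ∈ Set.Icc (0 : ℝ) Γ.T, SPEConstraint x k t) (i : Fin 2) {τ : Γ.Strategy}
    (hτ : Γ.IsMeasurableStrategy τ) (e : ℝ × (Fin 2 → Γ.A)) (h : Γ.History) {t : ℝ} (h0 : 0 ≤ t)
    (ht : t ≤ Γ.T) :
    Γ.expectedPayoff (Function.update (Γ.LRProfile x k) i τ) i (e :: h) t ≤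
      Γ.expectedPayoff (Γ.LRProfile x k) i (e :: h) t := by
  obtain ⟨C, hC⟩ := bddAbove_G_of_constraint hint hk hc
  have hbound : ∀ C : ℝ, IntegrableOn (fun s => |Γ.u Γ.aN Γ.aN| + (|Γ.u (x s) (x s)| + |C|))
      (Set.Ioc 0 t) := fun C => (integrableOn_const (by simp)).add
    ((integrableOn_diag hint ht).abs.add (integrableOn_const (by simp)))
  -- One function of the last arrival serves both as upper bound for the deviation and as two-sided
  -- bound for the hybrids.
  have hF := (Γ.integrable_last_arrival h0 (Γ.u (e.2 i) (e.2 i.rev))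
    (f := fun s => |Γ.u Γ.aN Γ.aN| + (|Γ.u (x s) (x s)| + |C|))
    (by have := Γ.measurable_u_diag hx; fun_prop) (hbound C)).1
  have hlast : ∀ᵐ w ∂Γ.waitingLaw, ∀ n, numArrivals t w = n + 1 →
      arrival t w n ∈ Set.Icc 0 Γ.T := by
    filter_upwards [Γ.ae_waiting_nonneg, Γ.ae_exists_arrival_neg t] with w hw hfin n hn
    exact ⟨((numArrivals_eq_succ_iff hw hfin n).1 hn).1, (arrival_le t hw n).trans ht⟩
  refine expectedPayoff_update_le (isMeasurableStrategy_LRProfile hx)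
    (oneShotOptimal_LRProfile hx hint hk hc)
    (fun i e h t h0 ht => (integral_realizedPayoff_LR hx hint i e h h0 ht).1)
    i hτ e h h0 ht hF hF ?_ fun n => ?_
  · filter_upwards [hlast] with w hw
    unfold realizedPayoff
    rcases hN : numArrivals t w with _ | n
    · exact le_rfl
    · exact finalPayoff_deviation_le _ _ _ _ (Function.update_of_ne (rev_ne_self i) _ _)
        (hC _ (hw n hN))
  -- The last choice comes after the return to limited retaliation, so the final profile is
  -- diagonal.
  · refine ae_of_all _ fun w hn => ?_
    unfold realizedPayoff
    rcases hN : numArrivals t w with _ | m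
    · omega
    · rw [if_neg (Nat.succ_ne_zero m), play]
      have hlen : (e :: h).length + n ≤ (Γ.play (Function.update (Γ.LRProfile x k) i
          (followUntil ((e :: h).length + n) τ (Γ.LRProfile x k i))) (e :: h) t w m).length := by
        rw [length_play]; omega
      simp only [choose, finalPayoff, update_followUntil_of_le i τ _ hlen, Nat.add_sub_cancel]
      exact (abs_u_LR_le _ _).trans (add_le_add_right (le_add_of_nonneg_right (abs_nonneg C)) _)

lemma IsHistory.le_T {h : Γ.History} (hh : Γ.IsHistory h) {t : ℝ} (ht : Γ.ChoiceAt h t) :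
    t ≤ Γ.T := by
  induction h generalizing t with
  | nil => exact le_of_eq ht
  | cons e h ih => exact ht.2.le.trans (ih hh.2 hh.1)

lemma ChoiceAt.nonneg {h : Γ.History} {t : ℝ} (ht : Γ.ChoiceAt h t) : 0 ≤ t := by
  cases h with
  | nil => exact Γ.T_pos.le.trans (le_of_eq (Eq.symm ht))
  | cons e h => exact ht.1

lemma isSPE_of_constraint (hx : Measurable x)
    (hint : IntervalIntegrable (fun s => Γ.u (x s) (x s)) volume 0 Γ.T) (hk : k ∈ Set.Ioo (0 : ℝ) 1)
    (hc : ∀ t ∈ Set.Icc (0 : ℝ) Γ.T, SPEConstraint x k t) : Γ.IsSPE (Γ.LRProfile x k) where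
  measurable := isMeasurableStrategy_LRProfile hx
  at_choice h t hh ht i τ hτ := by
    have h0 := ht.nonneg
    have hT := hh.le_T ht
    -- First replace the continuation after the deviator's choice at `t` by conformity, then that
    -- choice itself.
    refine (expectedPayoff_update_LR_le hx hint hk hc i hτ _ h h0 hT).trans ?_
    unfold choose
    rw [expectedPayoff_of_integrable (integral_realizedPayoff_LR hx hint i _ h h0 hT).1,
      expectedPayoff_of_integrable (integral_realizedPayoff_LR hx hint i _ h h0 hT).1,
      EReal.coe_le_coe_iff]
    exact oneShotOptimal_LRProfile hx hint hk hc i h t _ h0 hT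
      (by rw [Function.update_of_ne (rev_ne_self i)])
  between_choices e h t hh h0 ht i τ hτ :=
    expectedPayoff_update_LR_le hx hint hk hc i hτ e h h0 (ht.trans (hh.2.le_T hh.1))

lemma exists_conforming_history (x : ℝ → Γ.A) (k : ℝ) {t : ℝ} (ht : t ∈ Set.Icc (0 : ℝ) Γ.T) :
    ∃ h, Γ.IsHistory h ∧ Γ.ChoiceAt h t ∧ ¬ Γ.Retaliating x k h t := by
  rcases eq_or_lt_of_le ht.2 with h | h
  · exact ⟨[], trivial, h, fun hr => hr⟩
  · exact ⟨[(Γ.T, fun _ => x Γ.T)], ⟨rfl, trivial⟩, ⟨ht.1, h⟩, by simp [Retaliating]⟩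

lemma deviation_le_of_isSPE (hx : Measurable x)
    (hint : IntervalIntegrable (fun s => Γ.u (x s) (x s)) volume 0 Γ.T) (hk : k ∈ Set.Ioo (0 : ℝ) 1)
    (hspe : Γ.IsSPE (Γ.LRProfile x k)) {t : ℝ} (ht : t ∈ Set.Icc (0 : ℝ) Γ.T) {a : Γ.A}
    (ha : a ≠ x t) :
    (Γ.u a (x t) - Γ.u (x t) (x t)) * Real.exp (-Γ.rate * t) ≤
      ∫ s in (t - k * t)..t, Γ.L (x s) * (Γ.rate * Real.exp (-Γ.rate * s)) := by
  obtain ⟨h, hh, hch, hr⟩ := exists_conforming_history x k ht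
  -- Triggering by history length keeps `τ` measurable, and in this subgame it affects only the
  -- choice at `t`.
  set τ : Γ.Strategy := fun g s => if g.length = h.length then a else Γ.LR x k g s with hτ
  have hτm : Γ.IsMeasurableStrategy τ :=
    isMeasurableStrategy_of_length (isMeasurableStrategy_LR hx) (τ := fun _ _ => a)
      (fun n => measurable_const) (· = h.length)
  have hle := hspe.at_choice h t hh hch 0 τ hτm
  set b : Fin 2 → Γ.A := fun j => Function.update (Γ.LRProfile x k) 0 τ j h t with hb
  have hb0 : b 0 = a := by simp [hb, hτ]
  have hb1 : b (Fin.rev 0) = x t := by simp [hb, LRProfile, LR, hr]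
  have hconf : Γ.choose (Γ.LRProfile x k) h t = (t, fun _ => x t) :: h := by
    simp [choose, LRProfile, LR, hr]
  have hdev : Γ.realizedPayoff (Function.update (Γ.LRProfile x k) 0 τ) 0 ((t, b) :: h) t =
      Γ.realizedPayoff (Γ.LRProfile x k) 0 ((t, b) :: h) t := by
    funext w
    refine realizedPayoff_congr 0 t w fun g s j hg _ => ?_
    have hg' : g.length ≠ h.length := by
      rw [List.length_cons] at hg; omega
    rcases eq_or_eq_rev 0 j with rfl | rfl
    · simp [hτ, hg', LRProfile]
    · rw [Function.update_of_ne (rev_ne_self 0)]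
  have hi := integral_realizedPayoff_LR (k := k) hx hint 0 (t, b) h ht.1 ht.2
  have hi' := integral_realizedPayoff_LR (k := k) hx hint 0 (t, fun _ => x t) h ht.1 ht.2
  have hexp : Γ.expectedPayoff (Function.update (Γ.LRProfile x k) 0 τ) 0 ((t, b) :: h) t =
      Γ.expectedPayoff (Γ.LRProfile x k) 0 ((t, b) :: h) t := by
    unfold expectedPayoff; rw [hdev]
  change Γ.expectedPayoff _ 0 ((t, b) :: h) t ≤ _ at hle
  rw [hexp, hconf, expectedPayoff_of_integrable hi.1, expectedPayoff_of_integrable hi'.1,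
    EReal.coe_le_coe_iff, hi.2, hi'.2] at hle
  have hsub := pathValue_sub_of_deviation (b := b) hx hint hk ht.1 ht.2 hr (by rwa [hb0]) hb1
  rw [hb0] at hsub
  simp only at hle
  linarith

/-- If `x t` is its own best reply, `G (x t) = 0` but the loss must still be shown nonnegative. In a
nondegenerate interval other actions approach `x t`, and the inequality is closed in the action. In
a one-point action space both sides vanish. -/
lemma constraint_of_isSPE (hx : Measurable x)
    (hint : IntervalIntegrable (fun s => Γ.u (x s) (x s)) volume 0 Γ.T) (hk : k ∈ Set.Ioo (0 : ℝ) 1)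
    (hspe : Γ.IsSPE (Γ.LRProfile x k)) {t : ℝ} (ht : t ∈ Set.Icc (0 : ℝ) Γ.T) :
    SPEConstraint x k t := by
  unfold SPEConstraint
  obtain ⟨m, hm⟩ := Γ.exists_G_eq (x t)
  by_cases hsub : Subsingleton Γ.A
  · have hL : ∀ s, Γ.L (x s) = 0 := fun s => by
      unfold L; rw [Subsingleton.elim (x s) Γ.aN, sub_self]
    simp [hm, hL, Subsingleton.elim m (x t)]
  · rw [not_subsingleton_iff_nontrivial] at hsub
    rw [hm]
    -- Connectedness and nontriviality exclude isolated points, which gives the density below.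
    have : ConnectedSpace Γ.A := Subtype.connectedSpace
      ⟨⟨x t, (x t).2⟩, Γ.convex_A.isPreconnected⟩
    have hclosed : IsClosed {a : Γ.A | (Γ.u a (x t) - Γ.u (x t) (x t)) * Real.exp (-Γ.rate * t) ≤
        ∫ s in (t - k * t)..t, Γ.L (x s) * (Γ.rate * Real.exp (-Γ.rate * s))} := by
      have : Continuous fun a : Γ.A => Γ.u a (x t) :=
        Γ.continuous_u.comp (continuous_id.prodMk continuous_const)
      exact isClosed_le (by fun_prop) continuous_const
    have hdense : Dense ({x t}ᶜ : Set Γ.A) := dense_compl_singleton (x t)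
    exact (hclosed.closure_subset_iff.2 fun a ha =>
      deviation_le_of_isSPE hx hint hk hspe ht ha) (hdense m)

end Equilibrium

end RevisionGame

/-- The values of the plan `x` outside `[0, T]` play no role. -/
theorem theorem1 (Γ : RevisionGame) (x : ℝ → Γ.A) (hx : Measurable x)
    (hint : IntervalIntegrable (fun s => Γ.u (x s) (x s)) MeasureTheory.volume 0 Γ.T)
    (k : ℝ) (hk : k ∈ Set.Ioo (0 : ℝ) 1) :
    Γ.IsSPE (Γ.LRProfile x k) ↔
      ∀ t ∈ Set.Icc (0 : ℝ) Γ.T,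
        Γ.G (x t) * Real.exp (-Γ.rate * t) ≤
          ∫ s in (t - k * t)..t, Γ.L (x s) * (Γ.rate * Real.exp (-Γ.rate * s)) :=
  ⟨fun hspe _ ht => RevisionGame.constraint_of_isSPE hx hint hk hspe ht,
    fun hc => RevisionGame.isSPE_of_constraint hx hint hk hc⟩
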